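/- All vector spaces are over \(\mathbb Q\). A differential graded Lie algebra (DGL) is a \(\mathbb Z\)-graded Lie algebra \(L=\bigoplus_{p\in\mathbb Z}L_p\), with graded antisymmetry \([u,v]=-(-1)^{|u||v|}[v,u]\) and the graded Jacobi identity, together with a linear derivation \(\partial\) of degree \(-1\) with \(\partial^2=0\). Morphisms of DGL's are linear maps of degree \(0\) commuting with brackets and differentials. Put \(L^1=L\) and \(L^n=[L,L^{n-1}]\) for \(n\ge 2\). The completion of a graded Lie algebra \(L\) is \(\widehat L=\varprojlim_n L/L^n\), formed in each degree, and \(L\) is complete if the canonical map \(L\to\widehat L\) is an isomorphism. Let \(\mathrm{MC}(L)\) be the set of Maurer-Cartan elements of \(L\), that is, of those \(z\in L_{-1}\) with \(\partial z+\tfrac12[z,z]=0\). For a complete DGL \(L\), \(y\in L_0\) and \(z\in \mathrm{MC}(L)\), let \[ y\,\mathcal G\,z=\sum_{i\ge 0}\frac{\mathrm{ad}_y^i(z)}{i!}-\sum_{i\ge 0}\frac{\mathrm{ad}_y^i(\partial y)}{(i+1)!}. \] The Lawrence-Sullivan interval is the DGL \(\mathfrak L=(\widehat{\mathbb L}(a,b,x),\partial)\),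 the completion of the free graded Lie algebra on generators \(a,b\) of degree \(-1\) and \(x\) of degree \(0\), with the differential for which \(a\) and \(b\) are Maurer-Cartan elements and \[ \partial x=[x,b]+\sum_{n\ge 0}\frac{B_n}{n!}\,\mathrm{ad}_x^n(b-a), \] where \(B_n\) are the Bernoulli numbers (\(B_1=-\tfrac12\)). Proposition. Let \(L\) be a complete DGL, \(z,z'\in \mathrm{MC}(L)\) and \(y\in L_0\). Then the following assertions are equivalent: 1. \(y\,\mathcal G\,z=z'\); 2. there exists a DGL morphism \(\varphi\colon\mathfrak L\to L\) with \(\varphi(a)=z'\), \(\varphi(b)=z\) and \(\varphi(x)=y\). -/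

import Mathlib

universe u v

/-- A `ℤ`-graded Lie algebra over `ℚ`, given by its homogeneous components `X p`.  The bracket of
elements of degrees `p` and `q` lives in degree `r` for every `r` with `p + q = r`. -/
structure GLA where
  X : ℤ → Type u
  [addCommGroup : ∀ p, AddCommGroup (X p)]
  [module : ∀ p, Module ℚ (X p)]
  br : ∀ {p q r : ℤ}, p + q = r → X p →ₗ[ℚ] X q →ₗ[ℚ] X r
  antisymm : ∀ {p q r : ℤ} (h : p + q = r) (h' : q + p = r) (x : X p) (y : X q),
    br h x y = -((-1 : ℚ) ^ (p * q) • br h' y x)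
  jacobi : ∀ {p q r pq qr rp s : ℤ} (hpq : p + q = pq) (hqr : q + r = qr) (hrp : r + p = rp)
    (h₁ : p + qr = s) (h₂ : q + rp = s) (h₃ : r + pq = s) (x : X p) (y : X q) (z : X r),
    (-1 : ℚ) ^ (p * r) • br h₁ x (br hqr y z) + (-1 : ℚ) ^ (q * p) • br h₂ y (br hrp z x)
      + (-1 : ℚ) ^ (r * q) • br h₃ z (br hpq x y) = 0

attribute [instance] GLA.addCommGroup GLA.module

/-- A differential graded Lie algebra (DGL) over `ℚ`: the differential is a linear derivation of
degree `-1` and square zero. -/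
structure DGL extends GLA.{u} where
  d : ∀ {p q : ℤ}, q + 1 = p → X p →ₗ[ℚ] X q
  leibniz : ∀ {p q r p' q' r' : ℤ} (h : p + q = r) (hp : p' + 1 = p) (hq : q' + 1 = q)
    (hr : r' + 1 = r) (h₁ : p' + q = r') (h₂ : p + q' = r') (x : X p) (y : X q),
    d hr (br h x y) = br h₁ (d hp x) y + (-1 : ℚ) ^ p • br h₂ x (d hq y)
  d_d : ∀ {p q r : ℤ} (h : q + 1 = p) (h' : r + 1 = q) (x : X p), d h' (d h x) = 0

/-- Morphisms of DGL's: linear maps of degree `0` commuting with brackets and differentials. -/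
structure DGLHom (L : DGL.{u}) (M : DGL.{v}) where
  toFun : ∀ p : ℤ, L.X p →ₗ[ℚ] M.X p
  map_br : ∀ {p q r : ℤ} (h : p + q = r) (x : L.X p) (y : L.X q),
    toFun r (L.br h x y) = M.br h (toFun p x) (toFun q y)
  map_d : ∀ {p q : ℤ} (h : q + 1 = p) (x : L.X p), toFun q (L.d h x) = M.d h (toFun p x)

/-- Maurer-Cartan elements: `z` of degree `-1` with `∂ z + (1/2) [z, z] = 0`. -/
def DGL.IsMC (L : DGL.{u}) (z : L.X (-1)) : Prop :=
  L.d (q := -2) (by norm_num) z + (1 / 2 : ℚ) • L.br (r := -2) (by norm_num) z z = 0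

namespace GLA

variable (L : GLA.{u})

/-- `ad_x` for `x` of degree `0`, as an endomorphism of each homogeneous component. -/
def ad (x : L.X 0) (p : ℤ) : Module.End ℚ (L.X p) := L.br (zero_add p) x

/-- Lower central series: `L.lcs n p` is the degree `p` part of `L ^ (n + 1)`, where `L ^ 1 = L` and
`L ^ (n + 1) = [L, L ^ n]`. -/
def lcs : ℕ → ∀ p : ℤ, Submodule ℚ (L.X p)
  | 0, _ => ⊤
  | n + 1, r => Submodule.span ℚ
      {w | ∃ (p q : ℤ) (h : p + q = r) (x : L.X p) (y : L.X q), y ∈ lcs n q ∧ w = L.br h x y}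

variable {L}

theorem br_mem_lcs_succ {n : ℕ} {p q r : ℤ} (h : p + q = r) (x : L.X p) {y : L.X q}
    (hy : y ∈ L.lcs n q) : L.br h x y ∈ L.lcs (n + 1) r :=
  Submodule.subset_span ⟨p, q, h, x, y, hy, rfl⟩

theorem lcs_succ_le (n : ℕ) (r : ℤ) : L.lcs (n + 1) r ≤ L.lcs n r := by
  induction n generalizing r with
  | zero => exact le_top
  | succ n ih =>
    refine Submodule.span_le.2 ?_
    rintro _ ⟨p, q, h, x, y, hy, rfl⟩
    exact br_mem_lcs_succ h x (ih q hy)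

theorem br_mem_lcs_succ' {n : ℕ} {p q r : ℤ} (h : p + q = r) {x : L.X p} (y : L.X q)
    (hx : x ∈ L.lcs n p) : L.br h x y ∈ L.lcs (n + 1) r := by
  rw [L.antisymm h (by omega)]
  exact neg_mem (Submodule.smul_mem _ _ (br_mem_lcs_succ _ y hx))

theorem ad_pow_mem_lcs (x : L.X 0) {p : ℤ} (w : L.X p) (i : ℕ) :
    (L.ad x p ^ i) w ∈ L.lcs i p := by
  induction i with
  | zero => trivial
  | succ i ih =>
    rw [pow_succ', Module.End.mul_apply]
    exact br_mem_lcs_succ _ x ih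

variable (L)

/-- The bracket induced on the quotients `L / L ^ (n + 1)`. -/
def quotBr (n : ℕ) {p q r : ℤ} (h : p + q = r) :
    (L.X p ⧸ L.lcs n p) →ₗ[ℚ] (L.X q ⧸ L.lcs n q) →ₗ[ℚ] (L.X r ⧸ L.lcs n r) :=
  (L.lcs n p).liftQ
    { toFun := fun x => (L.lcs n q).mapQ (L.lcs n r) (L.br h x)
        (fun _ hy => lcs_succ_le n r (br_mem_lcs_succ h x hy))
      map_add' := fun x x' => by
        ext y
        simp
      map_smul' := fun c x => by
        ext y
        simp }
    (fun x hx => by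
      rw [LinearMap.mem_ker]
      ext y
      simpa using lcs_succ_le n r (br_mem_lcs_succ' h y hx))

theorem quotBr_mk (n : ℕ) {p q r : ℤ} (h : p + q = r) (x : L.X p) (y : L.X q) :
    L.quotBr n h ((L.lcs n p).mkQ x) ((L.lcs n q).mkQ y) = (L.lcs n r).mkQ (L.br h x y) := rfl

/-- The quotient graded Lie algebra `L / L ^ (n + 1)`. -/
def quot (n : ℕ) : GLA.{u} where
  X p := L.X p ⧸ L.lcs n p
  br h := L.quotBr n h
  antisymm {p q r} h h' x y := by
    obtain ⟨x, rfl⟩ := (L.lcs n p).mkQ_surjective x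
    obtain ⟨y, rfl⟩ := (L.lcs n q).mkQ_surjective y
    rw [quotBr_mk, quotBr_mk, L.antisymm h h', map_neg, map_smul]
  jacobi {p q r pq qr rp s} hpq hqr hrp h₁ h₂ h₃ x y z := by
    obtain ⟨x, rfl⟩ := (L.lcs n p).mkQ_surjective x
    obtain ⟨y, rfl⟩ := (L.lcs n q).mkQ_surjective y
    obtain ⟨z, rfl⟩ := (L.lcs n r).mkQ_surjective z
    simp only [quotBr_mk]
    exact (L.lcs n s).mkQ.map_zero ▸
      congrArg (L.lcs n s).mkQ (L.jacobi hpq hqr hrp h₁ h₂ h₃ x y z)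

/-- The projection `L / L ^ (n + 2) → L / L ^ (n + 1)`. -/
def trans (n : ℕ) (p : ℤ) : (L.X p ⧸ L.lcs (n + 1) p) →ₗ[ℚ] (L.X p ⧸ L.lcs n p) :=
  Submodule.factor (lcs_succ_le n p)

theorem trans_mk (n : ℕ) (p : ℤ) (x : L.X p) :
    L.trans n p ((L.lcs (n + 1) p).mkQ x) = (L.lcs n p).mkQ x := rfl

theorem trans_quotBr (n : ℕ) {p q r : ℤ} (h : p + q = r) (x : L.X p ⧸ L.lcs (n + 1) p)
    (y : L.X q ⧸ L.lcs (n + 1) q) :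
    L.trans n r (L.quotBr (n + 1) h x y) = L.quotBr n h (L.trans n p x) (L.trans n q y) := by
  obtain ⟨x, rfl⟩ := (L.lcs (n + 1) p).mkQ_surjective x
  obtain ⟨y, rfl⟩ := (L.lcs (n + 1) q).mkQ_surjective y
  rfl

/-- The degree `p` component of the completion: the projective limit of the degree `p` components
of the quotients `L / L ^ n`. -/
def complX (p : ℤ) : Submodule ℚ (∀ n : ℕ, L.X p ⧸ L.lcs n p) where
  carrier := {w | ∀ n, L.trans n p (w (n + 1)) = w n}
  add_mem' hv hw n := by simp [hv n, hw n]
  zero_mem' n := by simp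
  smul_mem' c w hw n := by simp [hw n]

/-- The bracket of the completion, induced by the brackets of the quotients. -/
def complBr {p q r : ℤ} (h : p + q = r) : L.complX p →ₗ[ℚ] L.complX q →ₗ[ℚ] L.complX r :=
  LinearMap.mk₂ ℚ
    (fun v w => ⟨fun n => L.quotBr n h (v.1 n) (w.1 n), fun n => by
      rw [trans_quotBr, v.2 n, w.2 n]⟩)
    (fun v v' w => by ext n; simp)
    (fun c v w => by ext n; simp)
    (fun v w w' => by ext n; simp)
    (fun c v w => by ext n; simp)

/-- The completion of a graded Lie algebra: the projective limit of the quotients `L / L ^ n` (in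
the category of graded Lie algebras, that is, degree by degree). -/
def completion : GLA.{u} where
  X p := L.complX p
  br h := L.complBr h
  antisymm h h' x y := by
    ext n
    exact (L.quot n).antisymm h h' (x.1 n) (y.1 n)
  jacobi hpq hqr hrp h₁ h₂ h₃ x y z := by
    ext n
    exact (L.quot n).jacobi hpq hqr hrp h₁ h₂ h₃ (x.1 n) (y.1 n) (z.1 n)

/-- The canonical map from `L` to its completion. -/
def toCompletion (p : ℤ) : L.X p →ₗ[ℚ] L.completion.X p where
  toFun x := ⟨fun n => (L.lcs n p).mkQ x, fun n => L.trans_mk n p x⟩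
  map_add' x y := by
    refine Subtype.ext (funext fun n => ?_)
    exact map_add (L.lcs n p).mkQ x y
  map_smul' c x := by
    refine Subtype.ext (funext fun n => ?_)
    exact map_smul (L.lcs n p).mkQ c x

/-- `L` is complete if the canonical map to its completion is an isomorphism. -/
def IsComplete : Prop := ∀ p : ℤ, Function.Bijective (L.toCompletion p)

/-- The element `∑ c_i ad_x ^ i (w)` of the completion of `L`; modulo `L ^ (n + 1)` only the terms
with `i < n` contribute. -/
def adSeries (c : ℕ → ℚ) (x : L.X 0) {p : ℤ} (w : L.X p) : L.completion.X p :=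
  ⟨fun n => (L.lcs n p).mkQ (∑ i ∈ Finset.range n, c i • (L.ad x p ^ i) w), fun n => by
    rw [trans_mk, Finset.sum_range_succ, map_add, add_eq_left, Submodule.mkQ_apply,
      Submodule.Quotient.mk_eq_zero]
    exact Submodule.smul_mem _ _ (ad_pow_mem_lcs x w n)⟩

end GLA

/-- The gauge action on a complete DGL,
`y 𝒢 z = ∑ ad_y ^ i (z) / i! - ∑ ad_y ^ i (∂ y) / (i + 1)!`. -/
noncomputable def DGL.gauge (L : DGL.{u}) (hL : L.IsComplete) (y : L.X 0) (z : L.X (-1)) :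
    L.X (-1) :=
  (LinearEquiv.ofBijective (L.toCompletion (-1)) (hL (-1))).symm
    (L.adSeries (fun i => 1 / (i.factorial : ℚ)) y z
      - L.adSeries (fun i => 1 / ((i + 1).factorial : ℚ)) y (L.d (by norm_num) y))

namespace FreeGLA

/-- Formal Lie expressions in generators `g : G` of degree `deg g`. -/
inductive Term {G : Type} (deg : G → ℤ) : ℤ → Type
  | of (g : G) : Term deg (deg g)
  | zero (p : ℤ) : Term deg p
  | add {p : ℤ} (s t : Term deg p) : Term deg p
  | smul {p : ℤ} (c : ℚ) (t : Term deg p) : Term deg p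
  | br {p q r : ℤ} (h : p + q = r) (s : Term deg p) (t : Term deg q) : Term deg r

/-- The congruence generated by the axioms of a graded Lie algebra. -/
inductive Rel {G : Type} (deg : G → ℤ) : ∀ {p : ℤ}, Term deg p → Term deg p → Prop
  | refl {p : ℤ} (s : Term deg p) : Rel deg s s
  | symm {p : ℤ} {s t : Term deg p} : Rel deg s t → Rel deg t s
  | trans {p : ℤ} {s t u : Term deg p} : Rel deg s t → Rel deg t u → Rel deg s u
  | add_congr {p : ℤ} {s s' t t' : Term deg p} :
      Rel deg s s' → Rel deg t t' → Rel deg (.add s t) (.add s' t')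
  | smul_congr {p : ℤ} (c : ℚ) {s s' : Term deg p} :
      Rel deg s s' → Rel deg (.smul c s) (.smul c s')
  | br_congr {p q r : ℤ} (h : p + q = r) {s s' : Term deg p} {t t' : Term deg q} :
      Rel deg s s' → Rel deg t t' → Rel deg (.br h s t) (.br h s' t')
  | add_assoc {p : ℤ} (s t u : Term deg p) :
      Rel deg (.add (.add s t) u) (.add s (.add t u))
  | add_comm {p : ℤ} (s t : Term deg p) : Rel deg (.add s t) (.add t s)
  | zero_add {p : ℤ} (s : Term deg p) : Rel deg (.add (.zero p) s) s
  | neg_add {p : ℤ} (s : Term deg p) : Rel deg (.add (.smul (-1) s) s) (.zero p)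
  | one_smul {p : ℤ} (s : Term deg p) : Rel deg (.smul 1 s) s
  | mul_smul {p : ℤ} (c c' : ℚ) (s : Term deg p) :
      Rel deg (.smul (c * c') s) (.smul c (.smul c' s))
  | smul_add {p : ℤ} (c : ℚ) (s t : Term deg p) :
      Rel deg (.smul c (.add s t)) (.add (.smul c s) (.smul c t))
  | add_smul {p : ℤ} (c c' : ℚ) (s : Term deg p) :
      Rel deg (.smul (c + c') s) (.add (.smul c s) (.smul c' s))
  | add_br {p q r : ℤ} (h : p + q = r) (s s' : Term deg p) (t : Term deg q) :
      Rel deg (.br h (.add s s') t) (.add (.br h s t) (.br h s' t))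
  | smul_br {p q r : ℤ} (h : p + q = r) (c : ℚ) (s : Term deg p) (t : Term deg q) :
      Rel deg (.br h (.smul c s) t) (.smul c (.br h s t))
  | br_add {p q r : ℤ} (h : p + q = r) (s : Term deg p) (t t' : Term deg q) :
      Rel deg (.br h s (.add t t')) (.add (.br h s t) (.br h s t'))
  | br_smul {p q r : ℤ} (h : p + q = r) (c : ℚ) (s : Term deg p) (t : Term deg q) :
      Rel deg (.br h s (.smul c t)) (.smul c (.br h s t))
  | antisymm {p q r : ℤ} (h : p + q = r) (h' : q + p = r) (s : Term deg p) (t : Term deg q) :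
      Rel deg (.br h s t) (.smul (-1) (.smul ((-1 : ℚ) ^ (p * q)) (.br h' t s)))
  | jacobi {p q r pq qr rp m : ℤ} (hpq : p + q = pq) (hqr : q + r = qr) (hrp : r + p = rp)
      (h₁ : p + qr = m) (h₂ : q + rp = m) (h₃ : r + pq = m)
      (s : Term deg p) (t : Term deg q) (u : Term deg r) :
      Rel deg
        (.add (.add (.smul ((-1 : ℚ) ^ (p * r)) (.br h₁ s (.br hqr t u)))
            (.smul ((-1 : ℚ) ^ (q * p)) (.br h₂ t (.br hrp u s))))
          (.smul ((-1 : ℚ) ^ (r * q)) (.br h₃ u (.br hpq s t))))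
        (.zero m)

variable {G : Type} (deg : G → ℤ)

/-- The setoid of the congruence `Rel`. -/
def termSetoid (p : ℤ) : Setoid (Term deg p) where
  r := Rel deg
  iseqv := ⟨Rel.refl, Rel.symm, Rel.trans⟩

/-- The degree `p` component of the free graded Lie algebra. -/
def Carrier (p : ℤ) : Type := Quotient (termSetoid deg p)

variable {deg}

/-- The class of a formal Lie expression. -/
def mk {p : ℤ} (t : Term deg p) : Carrier deg p := Quotient.mk (termSetoid deg p) t

theorem mk_eq {p : ℤ} {s t : Term deg p} (h : Rel deg s t) : mk s = mk t := Quotient.sound h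

theorem ind {p : ℤ} {P : Carrier deg p → Prop} (h : ∀ t, P (mk t)) (x : Carrier deg p) : P x :=
  Quotient.ind h x

instance (p : ℤ) : Zero (Carrier deg p) := ⟨mk (.zero p)⟩

instance (p : ℤ) : Add (Carrier deg p) :=
  ⟨Quotient.map₂ Term.add fun _ _ h _ _ h' => Rel.add_congr h h'⟩

instance (p : ℤ) : Neg (Carrier deg p) :=
  ⟨Quotient.map (Term.smul (-1)) fun _ _ h => Rel.smul_congr _ h⟩

instance (p : ℤ) : AddCommGroup (Carrier deg p) where
  add_assoc x y z := by
    induction x using ind; induction y using ind; induction z using ind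
    exact mk_eq (Rel.add_assoc _ _ _)
  add_comm x y := by
    induction x using ind; induction y using ind
    exact mk_eq (Rel.add_comm _ _)
  zero_add x := by
    induction x using ind
    exact mk_eq (Rel.zero_add _)
  add_zero x := by
    induction x using ind
    exact mk_eq ((Rel.add_comm _ _).trans (Rel.zero_add _))
  neg_add_cancel x := by
    induction x using ind
    exact mk_eq (Rel.neg_add _)
  nsmul := nsmulRec
  zsmul := zsmulRec

theorem mk_add {p : ℤ} (s t : Term deg p) : mk (.add s t) = mk s + mk t := rfl

theorem mk_zero (p : ℤ) : mk (deg := deg) (.zero p) = 0 := rfl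

instance (p : ℤ) : Module ℚ (Carrier deg p) :=
  let smul : ℚ → Carrier deg p → Carrier deg p := fun c =>
    Quotient.map (Term.smul c) fun _ _ h => Rel.smul_congr c h
  have smul_add' : ∀ (c : ℚ) (x y : Carrier deg p), smul c (x + y) = smul c x + smul c y := by
    intro c x y
    induction x using ind; induction y using ind
    exact mk_eq (Rel.smul_add _ _ _)
  have add_smul' : ∀ (c c' : ℚ) (x : Carrier deg p), smul (c + c') x = smul c x + smul c' x := by
    intro c c' x
    induction x using ind
    exact mk_eq (Rel.add_smul _ _ _)
  { smul := smul
    one_smul := fun x => by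
      induction x using ind
      exact mk_eq (Rel.one_smul _)
    mul_smul := fun c c' x => by
      induction x using ind
      exact mk_eq (Rel.mul_smul _ _ _)
    smul_add := smul_add'
    add_smul := add_smul'
    smul_zero := fun c => by
      have h := smul_add' c 0 0
      rw [add_zero] at h
      exact left_eq_add.1 h
    zero_smul := fun x => by
      have h := add_smul' 0 0 x
      rw [add_zero] at h
      exact left_eq_add.1 h }

theorem mk_smul {p : ℤ} (c : ℚ) (t : Term deg p) : mk (.smul c t) = c • mk t := rfl

/-- The bracket of the free graded Lie algebra. -/
def carrierBr {p q r : ℤ} (h : p + q = r) :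
    Carrier deg p →ₗ[ℚ] Carrier deg q →ₗ[ℚ] Carrier deg r :=
  LinearMap.mk₂ ℚ (Quotient.map₂ (Term.br h) fun _ _ hs _ _ ht => Rel.br_congr h hs ht)
    (fun x x' y => by
      induction x using ind; induction x' using ind; induction y using ind
      exact mk_eq (Rel.add_br _ _ _ _))
    (fun c x y => by
      induction x using ind; induction y using ind
      exact mk_eq (Rel.smul_br _ _ _ _))
    (fun x y y' => by
      induction x using ind; induction y using ind; induction y' using ind
      exact mk_eq (Rel.br_add _ _ _ _))
    (fun c x y => by
      induction x using ind; induction y using ind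
      exact mk_eq (Rel.br_smul _ _ _ _))

end FreeGLA

/-- The free graded Lie algebra on generators `g : G` of degree `deg g`. -/
def FreeGLA {G : Type} (deg : G → ℤ) : GLA.{0} where
  X := FreeGLA.Carrier deg
  br := FreeGLA.carrierBr
  antisymm h h' x y := by
    induction x using FreeGLA.ind; induction y using FreeGLA.ind
    refine (FreeGLA.mk_eq (FreeGLA.Rel.antisymm h h' _ _)).trans ?_
    rw [FreeGLA.mk_smul, neg_one_smul]
    rfl
  jacobi hpq hqr hrp h₁ h₂ h₃ x y z := by
    induction x using FreeGLA.ind; induction y using FreeGLA.ind; induction z using FreeGLA.ind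
    exact FreeGLA.mk_eq (FreeGLA.Rel.jacobi hpq hqr hrp h₁ h₂ h₃ _ _ _)

namespace FreeGLA

variable {G : Type} {deg : G → ℤ}

/-- The class of a formal Lie expression, as an element of the free graded Lie algebra. -/
def cls {p : ℤ} (t : Term deg p) : (FreeGLA deg).X p := mk t

theorem cls_surjective {p : ℤ} (x : (FreeGLA deg).X p) : ∃ t : Term deg p, cls t = x :=
  Quotient.exists_rep x

/-- The generators of the free graded Lie algebra. -/
def of (g : G) : (FreeGLA deg).X (deg g) := cls (.of g)

theorem cls_zero (p : ℤ) : cls (deg := deg) (.zero p) = 0 := rfl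

theorem cls_add {p : ℤ} (s t : Term deg p) : cls (.add s t) = cls s + cls t := rfl

theorem cls_smul {p : ℤ} (c : ℚ) (t : Term deg p) : cls (.smul c t) = c • cls t := rfl

theorem cls_br {p q r : ℤ} (h : p + q = r) (s : Term deg p) (t : Term deg q) :
    cls (.br h s t) = (FreeGLA deg).br h (cls s) (cls t) := rfl

variable (v : ∀ (g : G) (q : ℤ), q + 1 = deg g → (FreeGLA deg).completion.X q)

/-- The derivation of degree `-1` from formal Lie expressions to the completed free graded Lie
algebra with prescribed values `v` on the generators. -/
def termDer : ∀ {p : ℤ}, Term deg p → ∀ q : ℤ, q + 1 = p → (FreeGLA deg).completion.X q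
  | _, .of g, q, hq => v g q hq
  | _, .zero _, _, _ => 0
  | _, .add s t, q, hq => termDer s q hq + termDer t q hq
  | _, .smul c t, q, hq => c • termDer t q hq
  | _, .br (p := p) (q := p') h s t, q, hq =>
    (FreeGLA deg).completion.br (by omega) (termDer s (p - 1) (by omega))
        ((FreeGLA deg).toCompletion p' (cls t))
      + (-1 : ℚ) ^ p • (FreeGLA deg).completion.br (by omega)
        ((FreeGLA deg).toCompletion p (cls s)) (termDer t (p' - 1) (by omega))

theorem neg_one_zpow_cases (p : ℤ) : (Even p ∧ (-1 : ℚ) ^ p = 1) ∨ (Odd p ∧ (-1 : ℚ) ^ p = -1) :=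
  (Int.even_or_odd p).imp (fun h => ⟨h, h.neg_one_zpow⟩) (fun h => ⟨h, h.neg_one_zpow⟩)

theorem toCompletion_br (L : GLA.{u}) {p q r : ℤ} (h : p + q = r) (x : L.X p) (y : L.X q) :
    L.toCompletion r (L.br h x y) = L.completion.br h (L.toCompletion p x) (L.toCompletion q y) :=
  rfl

theorem antisymm_der (M : GLA.{u}) {p q r p' q' r' : ℤ} (h : p + q = r) (hp : p' + 1 = p)
    (hq : q' + 1 = q) (hr : r' + 1 = r) (dx : M.X p') (x : M.X p) (y : M.X q) (dy : M.X q') :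
    M.br (by omega) dx y + (-1 : ℚ) ^ p • M.br (by omega) x dy
      = (-1 : ℚ) • (-1 : ℚ) ^ (p * q) • ((M.br (by omega) dy x
        + (-1 : ℚ) ^ q • M.br (by omega) y dx : M.X r')) := by
  subst hp hq
  rw [M.antisymm (r := r') (by omega) (by omega) dx y,
    M.antisymm (r := r') (by omega) (by omega) x dy]
  rcases Int.even_or_odd p' with hp | hp <;> rcases Int.even_or_odd q' with hq | hq <;>
  simp [zpow_add₀, zpow_mul, mul_add, add_mul, hp.neg_one_zpow, hq.neg_one_zpow] <;> abel

theorem jacobi_der (M : GLA.{u}) {p q r pq qr rp m p' q' r' m' : ℤ} (hpq : p + q = pq)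
    (hqr : q + r = qr) (hrp : r + p = rp) (h₁ : p + qr = m)
    (hp : p' + 1 = p) (hq : q' + 1 = q) (hr : r' + 1 = r) (hm : m' + 1 = m)
    (x : M.X p) (y : M.X q) (z : M.X r) (dx : M.X p') (dy : M.X q') (dz : M.X r') :
    (-1 : ℚ) ^ (p * r) • (M.br (by omega) dx (M.br hqr y z) + (-1 : ℚ) ^ p • M.br (by omega) x
        (M.br (r := qr - 1) (by omega) dy z + (-1 : ℚ) ^ q • M.br (by omega) y dz))
    + (-1 : ℚ) ^ (q * p) • (M.br (by omega) dy (M.br hrp z x) + (-1 : ℚ) ^ q • M.br (by omega) y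
        (M.br (r := rp - 1) (by omega) dz x + (-1 : ℚ) ^ r • M.br (by omega) z dx))
    + (-1 : ℚ) ^ (r * q) • (M.br (by omega) dz (M.br hpq x y) + (-1 : ℚ) ^ r • M.br (by omega) z
        (M.br (r := pq - 1) (by omega) dx y + (-1 : ℚ) ^ p • M.br (by omega) x dy))
    = (0 : M.X m') := by
  subst hp hq hr
  have J₁ := M.jacobi (pq := pq - 1) (qr := qr) (rp := rp - 1) (s := m') (by omega) (by omega)
    (by omega) (by omega) (by omega) (by omega) dx y z
  have J₂ := M.jacobi (pq := pq - 1) (qr := qr - 1) (rp := rp) (s := m') (by omega) (by omega)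
    (by omega) (by omega) (by omega) (by omega) x dy z
  have J₃ := M.jacobi (pq := pq) (qr := qr - 1) (rp := rp - 1) (s := m') (by omega) (by omega)
    (by omega) (by omega) (by omega) (by omega) x y dz
  have K := congrArg₂ (· + ·) (congrArg₂ (· + ·) (congrArg ((-1 : ℚ) ^ r' • ·) J₁)
    (congrArg ((-1 : ℚ) ^ p' • ·) J₂)) (congrArg ((-1 : ℚ) ^ q' • ·) J₃)
  simp only [map_add, map_smul, smul_add, zpow_add₀ (show (-1 : ℚ) ≠ 0 by norm_num), zpow_mul,
    mul_add, add_mul, one_mul, mul_one, zpow_one]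
    at K ⊢
  rcases Int.even_or_odd p' with hp | hp <;> rcases Int.even_or_odd q' with hq | hq <;>
  rcases Int.even_or_odd r' with hr | hr <;>
  simp only [hp.neg_one_zpow, hq.neg_one_zpow, hr.neg_one_zpow, one_zpow] at K ⊢
  all_goals linear_combination (norm := module) (-1 : ℚ) • K

theorem termDer_rel {p : ℤ} {s t : Term deg p} (h : Rel deg s t) (q : ℤ) (hq : q + 1 = p) :
    termDer v s q hq = termDer v t q hq := by
  induction h generalizing q with
  | refl s => rfl
  | symm _ ih => exact (ih q hq).symm
  | trans _ _ ih ih' => exact (ih q hq).trans (ih' q hq)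
  | add_congr _ _ ih ih' => simp only [termDer, ih, ih']
  | smul_congr c _ ih => simp only [termDer, ih]
  | br_congr h hs ht ih ih' =>
    simp only [termDer, ih, ih', show cls _ = cls _ from mk_eq hs, show cls _ = cls _ from mk_eq ht]
  | add_assoc s t u => exact add_assoc _ _ _
  | add_comm s t => exact add_comm _ _
  | zero_add s => exact zero_add _
  | neg_add s => simp only [termDer, neg_one_smul, neg_add_cancel]
  | one_smul s => exact one_smul _ _
  | mul_smul c c' s => exact mul_smul _ _ _
  | smul_add c s t => exact smul_add _ _ _
  | add_smul c c' s => exact add_smul _ _ _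
  | add_br h s s' t =>
    simp only [termDer, cls_add, map_add, LinearMap.add_apply, smul_add]
    abel
  | smul_br h c s t =>
    simp only [termDer, cls_smul, map_smul, LinearMap.smul_apply, smul_add]
    rw [smul_comm c]
  | br_add h s t t' =>
    simp only [termDer, cls_add, map_add, smul_add]
    abel
  | br_smul h c s t =>
    simp only [termDer, cls_smul, map_smul, smul_add]
    rw [smul_comm c]
  | antisymm h h' s t => 
    exact antisymm_der (FreeGLA deg).completion h (sub_add_cancel _ 1) (sub_add_cancel _ 1) hq
      (termDer v s _ (sub_add_cancel _ 1)) ((FreeGLA deg).toCompletion _ (cls s))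
      ((FreeGLA deg).toCompletion _ (cls t)) (termDer v t _ (sub_add_cancel _ 1))
  | jacobi hpq hqr hrp h₁ h₂ h₃ s t u =>
    exact jacobi_der (FreeGLA deg).completion hpq hqr hrp h₁ (sub_add_cancel _ 1)
      (sub_add_cancel _ 1) (sub_add_cancel _ 1) hq ((FreeGLA deg).toCompletion _ (cls s))
      ((FreeGLA deg).toCompletion _ (cls t)) ((FreeGLA deg).toCompletion _ (cls u))
      (termDer v s _ (sub_add_cancel _ 1)) (termDer v t _ (sub_add_cancel _ 1))
      (termDer v u _ (sub_add_cancel _ 1))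

/-- The derivation of degree `-1` from the free graded Lie algebra to its completion with
prescribed values `v` on the generators. -/
def freeDer {p q : ℤ} (h : q + 1 = p) : (FreeGLA deg).X p →ₗ[ℚ] (FreeGLA deg).completion.X q where
  toFun := Quotient.lift (fun t => termDer v t q h) fun _ _ hst => termDer_rel v hst q h
  map_add' x y := by
    obtain ⟨s, rfl⟩ := cls_surjective x
    obtain ⟨t, rfl⟩ := cls_surjective y
    rfl
  map_smul' c x := by
    obtain ⟨s, rfl⟩ := cls_surjective x
    rfl

theorem freeDer_br {p q r p' q' r' : ℤ} (h : p + q = r) (hp : p' + 1 = p) (hq : q' + 1 = q)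
    (hr : r' + 1 = r) (h₁ : p' + q = r') (h₂ : p + q' = r') (x : (FreeGLA deg).X p)
    (y : (FreeGLA deg).X q) :
    freeDer v hr ((FreeGLA deg).br h x y) =
      (FreeGLA deg).completion.br h₁ (freeDer v hp x) ((FreeGLA deg).toCompletion q y)
        + (-1 : ℚ) ^ p • (FreeGLA deg).completion.br h₂ ((FreeGLA deg).toCompletion p x)
          (freeDer v hq y) := by
  obtain ⟨s, rfl⟩ := cls_surjective x
  obtain ⟨t, rfl⟩ := cls_surjective y
  obtain rfl : p' = p - 1 := by omega
  obtain rfl : q' = q - 1 := by omega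
  rfl

theorem freeDer_lcs (n : ℕ) {p q : ℤ} (h : q + 1 = p) {w : (FreeGLA deg).X p}
    (hw : w ∈ (FreeGLA deg).lcs n p) : (freeDer v h w).1 n = 0 := by
  induction n generalizing p q with
  | zero =>
    obtain ⟨y, hy⟩ := ((FreeGLA deg).lcs 0 q).mkQ_surjective ((freeDer v h w).1 0)
    rw [← hy, Submodule.mkQ_apply, Submodule.Quotient.mk_eq_zero]
    trivial
  | succ n ih =>
    refine Submodule.span_induction (p := fun w _ => (freeDer v h w).1 (n + 1) = 0)
      ?_ ?_ ?_ ?_ hw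
    · rintro _ ⟨i, j, hij, x, y, hy, rfl⟩
      rw [freeDer_br v hij (sub_add_cancel i 1) (sub_add_cancel j 1) h (by omega) (by omega)]
      obtain ⟨x', hx'⟩ := ((FreeGLA deg).lcs (n + 1) _).mkQ_surjective
        ((freeDer v (sub_add_cancel i 1) x).1 (n + 1))
      obtain ⟨y', hy'⟩ := ((FreeGLA deg).lcs (n + 1) _).mkQ_surjective
        ((freeDer v (sub_add_cancel j 1) y).1 (n + 1))
      have hy0 : y' ∈ (FreeGLA deg).lcs n (j - 1) := by
        have h0 := ih (sub_add_cancel j 1) hy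
        rw [← (freeDer v (sub_add_cancel j 1) y).2 n, ← hy', GLA.trans_mk] at h0
        exact (Submodule.Quotient.mk_eq_zero _).1 h0
      change (FreeGLA deg).quotBr (n + 1) _ ((freeDer v (sub_add_cancel i 1) x).1 (n + 1))
          (((FreeGLA deg).lcs (n + 1) j).mkQ y) + (-1 : ℚ) ^ i • (FreeGLA deg).quotBr (n + 1) _
          (((FreeGLA deg).lcs (n + 1) i).mkQ x)
          ((freeDer v (sub_add_cancel j 1) y).1 (n + 1)) = 0
      rw [← hx', ← hy', GLA.quotBr_mk, GLA.quotBr_mk, ← map_smul, ← map_add, Submodule.mkQ_apply,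
        Submodule.Quotient.mk_eq_zero]
      exact add_mem (GLA.br_mem_lcs_succ _ _ hy)
        (Submodule.smul_mem _ _ (GLA.br_mem_lcs_succ _ _ hy0))
    · rw [map_zero]
      rfl
    · intro x y _ _ hx hy
      rw [map_add]
      exact (congrArg₂ (· + ·) hx hy).trans (add_zero _)
    · intro c x _ hx
      rw [map_smul]
      exact (congrArg (c • ·) hx).trans (smul_zero _)

/-- The derivation induced by `freeDer` on the quotients of the free graded Lie algebra. -/
def quotDer (n : ℕ) {p q : ℤ} (h : q + 1 = p) :
    ((FreeGLA deg).quot n).X p →ₗ[ℚ] ((FreeGLA deg).quot n).X q :=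
  ((FreeGLA deg).lcs n p).liftQ
    { toFun := fun x => (freeDer v h x).1 n
      map_add' := fun x y => by
        rw [map_add]
        rfl
      map_smul' := fun c x => by
        rw [map_smul]
        rfl }
    (fun _ hx => freeDer_lcs v n h hx)

theorem quotDer_mk (n : ℕ) {p q : ℤ} (h : q + 1 = p) (x : (FreeGLA deg).X p) :
    quotDer v n h (((FreeGLA deg).lcs n p).mkQ x) = (freeDer v h x).1 n := rfl

theorem quotDer_br (n : ℕ) {p q r p' q' r' : ℤ} (h : p + q = r) (hp : p' + 1 = p)
    (hq : q' + 1 = q) (hr : r' + 1 = r) (h₁ : p' + q = r') (h₂ : p + q' = r')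
    (x : ((FreeGLA deg).quot n).X p) (y : ((FreeGLA deg).quot n).X q) :
    quotDer v n hr (((FreeGLA deg).quot n).br h x y) =
      ((FreeGLA deg).quot n).br h₁ (quotDer v n hp x) y
        + (-1 : ℚ) ^ p • ((FreeGLA deg).quot n).br h₂ x (quotDer v n hq y) := by
  obtain ⟨x, rfl⟩ := ((FreeGLA deg).lcs n p).mkQ_surjective x
  obtain ⟨y, rfl⟩ := ((FreeGLA deg).lcs n q).mkQ_surjective y
  exact congrArg (fun w => w.1 n) (freeDer_br v h hp hq hr h₁ h₂ x y)

/-- The continuous extension of `freeDer` to the completed free graded Lie algebra. -/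
def complDer {p q : ℤ} (h : q + 1 = p) :
    (FreeGLA deg).completion.X p →ₗ[ℚ] (FreeGLA deg).completion.X q where
  toFun w := ⟨fun n => quotDer v n h (w.1 n), fun n => by
    obtain ⟨x, hx⟩ := ((FreeGLA deg).lcs (n + 1) p).mkQ_surjective (w.1 (n + 1))
    have hx' : ((FreeGLA deg).lcs n p).mkQ x = w.1 n := by
      rw [← w.2 n, ← hx, GLA.trans_mk]
    change (FreeGLA deg).trans n q (quotDer v (n + 1) h (w.1 (n + 1))) = quotDer v n h (w.1 n)
    rw [← hx, ← hx']
    exact (freeDer v h x).2 n⟩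
  map_add' x y := by
    refine Subtype.ext (funext fun n => ?_)
    exact map_add (quotDer v n h) (x.1 n) (y.1 n)
  map_smul' c x := by
    refine Subtype.ext (funext fun n => ?_)
    exact map_smul (quotDer v n h) c (x.1 n)

theorem complDer_br {p q r p' q' r' : ℤ} (h : p + q = r) (hp : p' + 1 = p)
    (hq : q' + 1 = q) (hr : r' + 1 = r) (h₁ : p' + q = r') (h₂ : p + q' = r')
    (x : (FreeGLA deg).completion.X p) (y : (FreeGLA deg).completion.X q) :
    complDer v hr ((FreeGLA deg).completion.br h x y) =
      (FreeGLA deg).completion.br h₁ (complDer v hp x) y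
        + (-1 : ℚ) ^ p • (FreeGLA deg).completion.br h₂ x (complDer v hq y) :=
  Subtype.ext (funext fun n => quotDer_br v n h hp hq hr h₁ h₂ (x.1 n) (y.1 n))

theorem complDer_of (g : G) (q : ℤ) (h : q + 1 = deg g) :
    complDer v h ((FreeGLA deg).toCompletion _ (of g)) = v g q h := rfl

/-- The square of the derivation vanishes as soon as it vanishes on the generators. -/
theorem complDer_complDer
    (hv : ∀ (g : G) (q r : ℤ) (h : q + 1 = deg g) (h' : r + 1 = q),
      complDer v h' (v g q h) = 0)
    {p q r : ℤ} (h : q + 1 = p) (h' : r + 1 = q) (x : (FreeGLA deg).completion.X p) :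
    complDer v h' (complDer v h x) = 0 := by
  have key : ∀ {p : ℤ} (t : Term deg p) (q r : ℤ) (h : q + 1 = p) (h' : r + 1 = q),
      complDer v h' (complDer v h ((FreeGLA deg).toCompletion p (cls t))) = 0 := by
    intro p t
    induction t with
    | of g => exact hv g
    | zero p => intros; rw [cls_zero, map_zero, map_zero, map_zero]
    | add s t ih ih' =>
      intro q r h h'
      rw [cls_add, map_add, map_add, map_add, ih, ih', add_zero]
    | smul c t ih =>
      intro q r h h'
      rw [cls_smul, map_smul, map_smul, map_smul, ih, smul_zero]
    | @br i j k hij s t ih ih' =>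
      intro q r h h'
      obtain rfl : q = k - 1 := by omega
      obtain rfl : r = k - 1 - 1 := by omega
      rw [cls_br, toCompletion_br, complDer_br v hij (sub_add_cancel i 1) (sub_add_cancel j 1) h
        (by omega) (by omega), map_add, map_smul,
        complDer_br v _ (sub_add_cancel (i - 1) 1) (sub_add_cancel j 1) h' (by omega) (by omega),
        complDer_br v _ (sub_add_cancel i 1) (sub_add_cancel (j - 1) 1) h' (by omega) (by omega),
        ih, ih', map_zero, map_zero, LinearMap.zero_apply, zero_add, smul_zero, add_zero,
        zpow_sub₀ (by norm_num), zpow_one]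
      module
  refine Subtype.ext (funext fun n => ?_)
  obtain ⟨y, hy⟩ := ((FreeGLA deg).lcs n p).mkQ_surjective (x.1 n)
  obtain ⟨t, rfl⟩ := cls_surjective y
  have := congrArg (fun w => w.1 n) (key t q r h h')
  change quotDer v n h' (quotDer v n h (((FreeGLA deg).lcs n p).mkQ (cls t))) = 0 at this
  rwa [hy] at this

end FreeGLA

namespace LSAux

open Finset

theorem sum_square {W : Type*} [AddCommMonoid W] (F : ℕ → ℕ → W) (N K M : ℕ) (hK : 2 * N ≤ K)
    (hM : K ≤ M) (hF : ∀ i j, N ≤ i ∨ N ≤ j → F i j = 0) :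
    ∑ k ∈ range K, ∑ ij ∈ antidiagonal k, F ij.1 ij.2 = ∑ i ∈ range M, ∑ j ∈ range M, F i j := by
  rw [← Finset.sum_product' (range M) (range M) F,
    ← Finset.sum_filter_of_ne (s := range M ×ˢ range M) (p := fun ij => ij.1 + ij.2 < K),
    ← Finset.sum_fiberwise_of_maps_to (t := range K) (g := fun ij : ℕ × ℕ => ij.1 + ij.2)]
  · refine Finset.sum_congr rfl fun k hk => Finset.sum_congr ?_ fun _ _ => rfl
    ext ⟨i, j⟩
    simp only [HasAntidiagonal.mem_antidiagonal, mem_filter, mem_product, mem_range] at hk ⊢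
    omega
  · intro ij h
    simpa using (mem_filter.1 h).2
  · intro ij _ h
    by_contra h'
    exact h (hF _ _ (by omega))

/-- Evaluation of a power series at a nilpotent endomorphism, truncated in degree `M`. -/
noncomputable def ev {V : Type*} [AddCommGroup V] [Module ℚ V] (D : Module.End ℚ V) (M : ℕ)
    (f : PowerSeries ℚ) : Module.End ℚ V :=
  Polynomial.aeval D (PowerSeries.trunc M f)

section

variable {V W : Type*} [AddCommGroup V] [Module ℚ V] [AddCommGroup W] [Module ℚ W]

theorem ev_apply (D : Module.End ℚ V) (M : ℕ) (f : PowerSeries ℚ) (w : V) :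
    ev D M f w = ∑ k ∈ range M, PowerSeries.coeff k f • (D ^ k) w := by
  rw [ev, Polynomial.aeval_def, PowerSeries.eval₂_trunc_eq_sum_range, LinearMap.sum_apply]
  refine Finset.sum_congr rfl fun k _ => ?_
  rw [← Algebra.smul_def, LinearMap.smul_apply]

theorem ev_coe (D : Module.End ℚ V) (M : ℕ) (hD : D ^ M = 0) (P : Polynomial ℚ) :
    ev D M (P : PowerSeries ℚ) = Polynomial.aeval D P := by
  have h : (Polynomial.X : Polynomial ℚ) ^ M ∣ P - PowerSeries.trunc M (P : PowerSeries ℚ) := by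
    rw [Polynomial.X_pow_dvd_iff]
    intro k hk
    simp [PowerSeries.coeff_trunc, hk]
  obtain ⟨R, hR⟩ := h
  have := congrArg (Polynomial.aeval D) hR
  rw [map_sub, map_mul, map_pow, Polynomial.aeval_X, hD, zero_mul, sub_eq_zero] at this
  exact this.symm

theorem ev_mul (D : Module.End ℚ V) (M : ℕ) (hD : D ^ M = 0) (f g : PowerSeries ℚ) (w : V) :
    ev D M (f * g) w = ev D M f (ev D M g w) := by
  rw [← Module.End.mul_apply]
  congr 1
  rw [ev, ← PowerSeries.trunc_trunc_mul_trunc, ← Polynomial.coe_mul]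
  change ev D M _ = _
  rw [ev_coe D M hD, map_mul]
  rfl

theorem ev_one (D : Module.End ℚ V) (M : ℕ) (hD : D ^ M = 0) (w : V) : ev D M 1 w = w := by
  rw [← Polynomial.coe_one, ev_coe D M hD, map_one, Module.End.one_apply]

theorem ev_X (D : Module.End ℚ V) (M : ℕ) (hD : D ^ M = 0) (w : V) :
    ev D M PowerSeries.X w = D w := by
  rw [← Polynomial.coe_X, ev_coe D M hD, Polynomial.aeval_X]

/-- The power series `(e ^ t - 1) / t`. -/
noncomputable def gSeries : PowerSeries ℚ := PowerSeries.mk fun k => 1 / ((k + 1).factorial : ℚ)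

theorem X_mul_gSeries : PowerSeries.X * gSeries = PowerSeries.exp ℚ - 1 := by
  ext k
  cases k with
  | zero => simp
  | succ k =>
    rw [PowerSeries.coeff_succ_X_mul]
    simp [gSeries, PowerSeries.coeff_exp, PowerSeries.coeff_one]

theorem bernoulli_mul_gSeries : gSeries * bernoulliPowerSeries ℚ = 1 := by
  have h := bernoulliPowerSeries_mul_exp_sub_one ℚ
  rw [← X_mul_gSeries] at h
  have hX : (PowerSeries.X : PowerSeries ℚ) ≠ 0 := PowerSeries.X_ne_zero
  apply mul_left_cancel₀ hX
  rw [mul_one, ← mul_assoc, mul_comm]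
  exact h

variable (D : Module.End ℚ V) (D' : Module.End ℚ W) (B : V →ₗ[ℚ] V →ₗ[ℚ] W) (δ : V →ₗ[ℚ] W)
  (u : V)

theorem pow_leibniz (hB : ∀ v w, D' (B v w) = B (D v) w + B v (D w)) (k : ℕ) (v w : V) :
    (D' ^ k) (B v w) =
      ∑ ij ∈ antidiagonal k, (k.choose ij.1 : ℚ) • B ((D ^ ij.1) v) ((D ^ ij.2) w) := by
  induction k with
  | zero => simp
  | succ k ih =>
    rw [pow_succ', Module.End.mul_apply, ih, map_sum]
    have e : ∀ ij ∈ antidiagonal k, D' ((k.choose ij.1 : ℚ) • B ((D ^ ij.1) v) ((D ^ ij.2) w)) =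
        (k.choose ij.1 : ℚ) • B ((D ^ (ij.1 + 1)) v) ((D ^ ij.2) w) +
        (k.choose ij.1 : ℚ) • B ((D ^ ij.1) v) ((D ^ (ij.2 + 1)) w) := by
      intro ij _
      rw [map_smul, hB, smul_add, pow_succ', pow_succ', Module.End.mul_apply, Module.End.mul_apply]
    rw [sum_congr rfl e, sum_add_distrib, Finset.Nat.sum_antidiagonal_succ
      (f := fun ij => ((k + 1).choose ij.1 : ℚ) • B ((D ^ ij.1) v) ((D ^ ij.2) w))]
    have e' : ∑ ij ∈ antidiagonal k, (k.choose ij.1 : ℚ) • B ((D ^ ij.1) v) ((D ^ (ij.2 + 1)) w) =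
        B v ((D ^ (k + 1)) w) + ∑ ij ∈ antidiagonal k,
          (k.choose (ij.1 + 1) : ℚ) • B ((D ^ (ij.1 + 1)) v) ((D ^ ij.2) w) := by
      have h₁ := Finset.Nat.sum_antidiagonal_succ (n := k)
        (f := fun ij => (k.choose ij.1 : ℚ) • B ((D ^ ij.1) v) ((D ^ ij.2) w))
      have h₂ := Finset.Nat.sum_antidiagonal_succ' (n := k)
        (f := fun ij => (k.choose ij.1 : ℚ) • B ((D ^ ij.1) v) ((D ^ ij.2) w))
      rw [h₁] at h₂
      simpa using h₂.symm
    rw [e']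
    simp only [Nat.choose_succ_succ, Nat.cast_add, add_smul, sum_add_distrib, Nat.choose_zero_right,
      Nat.cast_one, one_smul, pow_zero, Module.End.one_apply]
    abel

theorem pow_der (hB : ∀ v w, D' (B v w) = B (D v) w + B v (D w))
    (hδ : ∀ w, δ (D w) = B u w + D' (δ w)) (k : ℕ) (w : V) :
    δ ((D ^ (k + 1)) w) = (D' ^ (k + 1)) (δ w) +
      ∑ ij ∈ antidiagonal k, ((k + 1).choose (ij.1 + 1) : ℚ) •
        B ((D ^ ij.1) u) ((D ^ ij.2) w) := by
  induction k with
  | zero => simp [hδ, add_comm]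
  | succ k ih =>
    rw [pow_succ', Module.End.mul_apply, hδ, ih, map_add, map_sum, pow_succ' D' (k + 1),
      Module.End.mul_apply]
    have e : ∀ ij ∈ antidiagonal k, D' (((k + 1).choose (ij.1 + 1) : ℚ) •
          B ((D ^ ij.1) u) ((D ^ ij.2) w)) =
        ((k + 1).choose (ij.1 + 1) : ℚ) • B ((D ^ (ij.1 + 1)) u) ((D ^ ij.2) w) +
        ((k + 1).choose (ij.1 + 1) : ℚ) • B ((D ^ ij.1) u) ((D ^ (ij.2 + 1)) w) := by
      intro ij _
      rw [map_smul, hB, smul_add, pow_succ', pow_succ', Module.End.mul_apply, Module.End.mul_apply]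
    rw [sum_congr rfl e, sum_add_distrib]
    have h₁ := Finset.Nat.sum_antidiagonal_succ (n := k)
      (f := fun ij => ((k + 1).choose ij.1 : ℚ) • B ((D ^ ij.1) u) ((D ^ ij.2) w))
    have h₂ := Finset.Nat.sum_antidiagonal_succ' (n := k)
      (f := fun ij => ((k + 1).choose (ij.1 + 1) : ℚ) • B ((D ^ ij.1) u) ((D ^ ij.2) w))
    simp only [Nat.choose_succ_succ (k + 1), Nat.cast_add, add_smul, sum_add_distrib]
    rw [h₁, h₂]
    simp
    abel

theorem ev_B (N : ℕ) (hB : ∀ v w, D' (B v w) = B (D v) w + B v (D w)) (hD : D ^ N = 0)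
    (v w : V) :
    ev D' (2 * N + 1) (PowerSeries.exp ℚ) (B v w) =
      B (ev D (2 * N + 1) (PowerSeries.exp ℚ) v) (ev D (2 * N + 1) (PowerSeries.exp ℚ) w) := by
  have hz : ∀ i, N ≤ i → D ^ i = 0 := fun i hi => pow_eq_zero_of_le hi hD
  simp only [ev_apply, pow_leibniz D D' B hB, map_sum, LinearMap.sum_apply]
  rw [Finset.sum_comm, ← sum_square _ N _ _ (by omega) le_rfl]
  · refine sum_congr rfl fun k _ => ?_
    rw [smul_sum]
    refine sum_congr rfl fun ij hij => ?_
    obtain rfl := HasAntidiagonal.mem_antidiagonal.1 hij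
    simp only [PowerSeries.coeff_exp, map_smul, LinearMap.smul_apply, smul_smul]
    congr 1
    rw [Nat.cast_add_choose]
    simp
    field_simp
  · rintro i j (h | h) <;> simp [hz _ h]

theorem B_ev (N : ℕ) (hD : D ^ N = 0) (f g : PowerSeries ℚ) (v w : V) :
    B (ev D (2 * N + 1) f v) (ev D (2 * N + 1) g w) = ∑ k ∈ range (2 * N), ∑ ij ∈ antidiagonal k,
      PowerSeries.coeff ij.2 g • PowerSeries.coeff ij.1 f • B ((D ^ ij.1) v) ((D ^ ij.2) w) := by
  have hz : ∀ i, N ≤ i → D ^ i = 0 := fun i hi => pow_eq_zero_of_le hi hD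
  simp only [ev_apply, map_sum, LinearMap.sum_apply, map_smul, LinearMap.smul_apply, smul_sum]
  rw [Finset.sum_comm, sum_square (fun i j => PowerSeries.coeff j g • PowerSeries.coeff i f •
    B ((D ^ i) v) ((D ^ j) w)) N (2 * N) (2 * N + 1) le_rfl (by omega)]
  rintro i j (h | h) <;> simp [hz _ h]

theorem der_ev_exp (N : ℕ) (hB : ∀ v w, D' (B v w) = B (D v) w + B v (D w))
    (hδ : ∀ w, δ (D w) = B u w + D' (δ w)) (hD : D ^ N = 0) (w : V) :
    δ (ev D (2 * N + 1) (PowerSeries.exp ℚ) w) =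
      ev D' (2 * N + 1) (PowerSeries.exp ℚ) (δ w) +
      B (ev D (2 * N + 1) gSeries u) (ev D (2 * N + 1) (PowerSeries.exp ℚ) w) := by
  rw [B_ev D B N hD]
  simp only [ev_apply, map_sum, map_smul]
  rw [sum_range_succ' _ (2 * N), sum_range_succ' (fun k => PowerSeries.coeff k (PowerSeries.exp ℚ)
    • (D' ^ k) (δ w)) (2 * N)]
  simp only [pow_der D D' B δ u hB hδ, smul_add, sum_add_distrib]
  have e : ∀ k ∈ range (2 * N), PowerSeries.coeff (k + 1) (PowerSeries.exp ℚ) •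
      ∑ ij ∈ antidiagonal k, ((k + 1).choose (ij.1 + 1) : ℚ) •
        B ((D ^ ij.1) u) ((D ^ ij.2) w) =
      ∑ ij ∈ antidiagonal k, PowerSeries.coeff ij.2 (PowerSeries.exp ℚ) •
        PowerSeries.coeff ij.1 gSeries • B ((D ^ ij.1) u) ((D ^ ij.2) w) := by
    intro k _
    rw [smul_sum]
    refine sum_congr rfl fun ij hij => ?_
    obtain rfl := HasAntidiagonal.mem_antidiagonal.1 hij
    simp only [PowerSeries.coeff_exp, smul_smul, gSeries, PowerSeries.coeff_mk]
    congr 1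
    rw [show ij.1 + ij.2 + 1 = (ij.1 + 1) + ij.2 by ring, Nat.cast_add_choose]
    simp
    field_simp
  rw [sum_congr rfl e]
  simp only [pow_zero, Module.End.one_apply]
  abel

theorem der_ev_g (N : ℕ) (hB : ∀ v w, D' (B v w) = B (D v) w + B v (D w))
    (hs : ∀ v w, B v w = B w v)
    (hδ : ∀ w, δ (D w) = B u w + D' (δ w)) (hD : D ^ N = 0) :
    δ (ev D (2 * N + 1) gSeries u) =
      ev D' (2 * N + 1) gSeries (δ u) +
      (1 / 2 : ℚ) • B (ev D (2 * N + 1) gSeries u) (ev D (2 * N + 1) gSeries u) := by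
  rw [B_ev D B N hD]
  simp only [ev_apply, map_sum, map_smul]
  rw [sum_range_succ' _ (2 * N), sum_range_succ' (fun k => PowerSeries.coeff k gSeries
    • (D' ^ k) (δ u)) (2 * N)]
  simp only [pow_der D D' B δ u hB hδ, smul_add, sum_add_distrib]
  have e : ∀ k ∈ range (2 * N), PowerSeries.coeff (k + 1) gSeries •
      ∑ ij ∈ antidiagonal k, ((k + 1).choose (ij.1 + 1) : ℚ) •
        B ((D ^ ij.1) u) ((D ^ ij.2) u) =
      (1 / 2 : ℚ) • ∑ ij ∈ antidiagonal k, PowerSeries.coeff ij.2 gSeries •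
        PowerSeries.coeff ij.1 gSeries • B ((D ^ ij.1) u) ((D ^ ij.2) u) := by
    intro k _
    have hswap : ∑ ij ∈ antidiagonal k, ((k + 1).choose (ij.1 + 1) : ℚ) •
          B ((D ^ ij.1) u) ((D ^ ij.2) u) =
        ∑ ij ∈ antidiagonal k, ((k + 1).choose (ij.2 + 1) : ℚ) •
          B ((D ^ ij.1) u) ((D ^ ij.2) u) := by
      rw [← Finset.Nat.sum_antidiagonal_swap]
      exact sum_congr rfl fun ij _ => by rw [Prod.fst_swap, Prod.snd_swap, hs]
    have hdouble : ∑ ij ∈ antidiagonal k, ((k + 1).choose (ij.1 + 1) : ℚ) •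
          B ((D ^ ij.1) u) ((D ^ ij.2) u) =
        (1 / 2 : ℚ) • ∑ ij ∈ antidiagonal k, ((k + 2).choose (ij.1 + 1) : ℚ) •
          B ((D ^ ij.1) u) ((D ^ ij.2) u) := by
      have h3 : ∑ ij ∈ antidiagonal k, ((k + 2).choose (ij.1 + 1) : ℚ) •
          B ((D ^ ij.1) u) ((D ^ ij.2) u) = ∑ ij ∈ antidiagonal k,
            ((k + 1).choose (ij.2 + 1) : ℚ) • B ((D ^ ij.1) u) ((D ^ ij.2) u) +
          ∑ ij ∈ antidiagonal k, ((k + 1).choose (ij.1 + 1) : ℚ) •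
            B ((D ^ ij.1) u) ((D ^ ij.2) u) := by
        rw [← sum_add_distrib]
        refine sum_congr rfl fun ij hij => ?_
        obtain rfl := HasAntidiagonal.mem_antidiagonal.1 hij
        rw [← add_smul, Nat.choose_succ_succ (ij.1 + ij.2 + 1), Nat.cast_add,
          ← Nat.choose_symm_of_eq_add (show ij.1 + ij.2 + 1 = (ij.2 + 1) + ij.1 by ring)]
      rw [h3, ← hswap]
      module
    rw [hdouble, smul_comm, smul_sum]
    congr 1
    refine sum_congr rfl fun ij hij => ?_
    obtain rfl := HasAntidiagonal.mem_antidiagonal.1 hij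
    simp only [smul_smul, gSeries, PowerSeries.coeff_mk]
    congr 1
    rw [show ij.1 + ij.2 + 2 = (ij.1 + 1) + (ij.2 + 1) by ring, Nat.cast_add_choose]
    field_simp
  rw [sum_congr rfl e, smul_sum]
  simp only [pow_zero, Module.End.one_apply]
  abel

theorem sq_zero (N : ℕ) (hB : ∀ v w, D' (B v w) = B (D v) w + B v (D w))
    (hs : ∀ v w, B v w = B w v)
    (hδ : ∀ w, δ (D w) = B u w + D' (δ w)) (hD : D ^ N = 0) (hD' : D' ^ N = 0) (a b : V)
    (ha : δ a = -(1 / 2 : ℚ) • B a a) (hb : δ b = -(1 / 2 : ℚ) • B b b)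
    (hu : u = D b + ∑ k ∈ range N, (bernoulli k / (k.factorial : ℚ)) • (D ^ k) (b - a)) :
    δ u = 0 := by
  have hM : D ^ (2 * N + 1) = 0 := pow_eq_zero_of_le (by omega) hD
  have hM' : D' ^ (2 * N + 1) = 0 := pow_eq_zero_of_le (by omega) hD'
  have hf : ∑ k ∈ range N, (bernoulli k / (k.factorial : ℚ)) • (D ^ k) (b - a) =
      ev D (2 * N + 1) (bernoulliPowerSeries ℚ) (b - a) := by
    rw [ev_apply]
    refine (sum_subset_zero_on_sdiff (range_subset_range.2 (by omega)) ?_ ?_)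
    · intro k hk
      simp only [mem_sdiff, mem_range] at hk
      rw [pow_eq_zero_of_le (show N ≤ k by omega) hD, LinearMap.zero_apply, smul_zero]
    · intro k _
      simp [bernoulliPowerSeries]
  rw [hf] at hu
  have hv : ev D (2 * N + 1) gSeries u = ev D (2 * N + 1) (PowerSeries.exp ℚ) b - a := by
    rw [hu, map_add, ← ev_mul D _ hM, bernoulli_mul_gSeries, ev_one D _ hM,
      ← ev_X D (2 * N + 1) hM b, ← ev_mul D _ hM, mul_comm gSeries,
      X_mul_gSeries]
    have : ev D (2 * N + 1) (PowerSeries.exp ℚ - 1) b =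
        ev D (2 * N + 1) (PowerSeries.exp ℚ) b - ev D (2 * N + 1) 1 b := by
      simp [ev]
    rw [this, ev_one D _ hM]
    abel
  have h₁ := der_ev_exp D D' B δ u N hB hδ hD b
  have h₂ := der_ev_g D D' B δ u N hB hs hδ hD
  rw [hb, map_smul, ev_B D D' B N hB hD] at h₁
  have hz : ev D' (2 * N + 1) gSeries (δ u) = 0 := by
    have ha' : a = ev D (2 * N + 1) (PowerSeries.exp ℚ) b - ev D (2 * N + 1) gSeries u := by
      rw [hv]
      abel
    generalize ev D (2 * N + 1) (PowerSeries.exp ℚ) b = E at *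
    generalize ev D (2 * N + 1) gSeries u = w at *
    rw [ha', map_sub, h₁, h₂] at ha
    simp only [map_sub, LinearMap.sub_apply, hs E w] at ha
    linear_combination (norm := module) (-1 : ℚ) • ha
  have := congrArg (ev D' (2 * N + 1) (bernoulliPowerSeries ℚ)) hz
  rwa [← ev_mul D' _ hM', mul_comm (bernoulliPowerSeries ℚ), bernoulli_mul_gSeries, ev_one D' _ hM', map_zero] at this

end

end LSAux

/-- The generators of the Lawrence-Sullivan interval. -/
inductive LSGen
  | a
  | b
  | x

namespace LSGen

/-- The degrees of the generators: `a` and `b` have degree `-1` and `x` has degree `0`. -/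
def deg : LSGen → ℤ
  | a => -1
  | b => -1
  | x => 0

/-- The free graded Lie algebra on `a`, `b`, `x`. -/
abbrev F : GLA.{0} := FreeGLA deg

/-- The generator `a` of the free graded Lie algebra. -/
def fa : F.X (-1) := FreeGLA.of a

/-- The generator `b` of the free graded Lie algebra. -/
def fb : F.X (-1) := FreeGLA.of b

/-- The generator `x` of the free graded Lie algebra. -/
def fx : F.X 0 := FreeGLA.of x

/-- `∂ a = -(1/2) [a, a]`, `∂ b = -(1/2) [b, b]` and
`∂ x = [x, b] + ∑ (B_n / n!) ad_x ^ n (b - a)`. -/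
noncomputable def dGen : ∀ (g : LSGen) (q : ℤ), q + 1 = deg g → F.completion.X q
  | a, q, h => -(1 / 2 : ℚ) • F.toCompletion q (F.br (by simp only [deg] at h; omega) fa fa)
  | b, q, h => -(1 / 2 : ℚ) • F.toCompletion q (F.br (by simp only [deg] at h; omega) fb fb)
  | x, q, h => (show -1 = q by simp only [deg] at h; omega) ▸
      (F.toCompletion (-1) (F.br (zero_add (-1)) fx fb)
        + F.adSeries (fun n => bernoulli n / (n.factorial : ℚ)) fx (fb - fa))

end LSGen

theorem GLA.ad_br (L : GLA.{u}) (x : L.X 0) {p q r : ℤ} (h : p + q = r) (v : L.X p) (w : L.X q) :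
    L.ad x r (L.br h v w) = L.br h (L.ad x p v) w + L.br h v (L.ad x q w) := by
  have J := L.jacobi (zero_add p) h (add_zero q) (zero_add r) h (by omega) x v w
  rw [L.antisymm (add_zero q) (zero_add q) w x, L.antisymm (by omega : q + p = r) h w] at J
  rcases FreeGLA.neg_one_zpow_cases (q * p) with ⟨_, hp⟩ | ⟨_, hp⟩ <;>
  · simp only [zero_mul, mul_zero, zpow_zero, one_smul, hp, map_neg, neg_smul, smul_neg,
      neg_neg] at J
    simp only [ad]
    linear_combination (norm := module) J

namespace LSGen

/-- The projection to the quotient. -/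
def pr (n : ℕ) (p : ℤ) : F.X p →ₗ[ℚ] (F.quot n).X p := (F.lcs n p).mkQ

theorem quot_ad_pow (n : ℕ) (y : F.X 0) {p : ℤ} (w : F.X p) (i : ℕ) :
    ((F.quot n).ad (pr n 0 y) p ^ i) (pr n p w) = pr n p ((F.ad y p ^ i) w) := by
  induction i with
  | zero => rfl
  | succ i ih =>
    rw [pow_succ', pow_succ', Module.End.mul_apply, Module.End.mul_apply, ih]
    rfl

theorem quot_ad_pow_eq_zero (n : ℕ) (y : F.X 0) (p : ℤ) :
    (F.quot n).ad (pr n 0 y) p ^ n = 0 := by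
  refine LinearMap.ext fun w => ?_
  obtain ⟨w, rfl⟩ := (F.lcs n p).mkQ_surjective w
  refine (quot_ad_pow n y w n).trans ?_
  exact (Submodule.Quotient.mk_eq_zero _).2 (GLA.ad_pow_mem_lcs y w n)

theorem br_triple (M : GLA.{u}) (g : M.X (-1)) :
    M.br (r := -3) (by norm_num) g (M.br (r := -2) (by norm_num) g g) = 0 := by
  have J := M.jacobi (pq := -2) (qr := -2) (rp := -2) (s := -3) (by norm_num) (by norm_num)
    (by norm_num) (by norm_num) (by norm_num) (by norm_num) g g g
  simp only [show ((-1 : ℤ) * (-1)) = 1 by norm_num, zpow_one] at J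
  linear_combination (norm := module) (-1 / 3 : ℚ) • J

theorem d_d_mc (g : F.X (-1)) (h : (-2 : ℤ) + 1 = -1) (h' : (-3 : ℤ) + 1 = -2)
    (hg : FreeGLA.complDer dGen h (F.toCompletion (-1) g) =
      -(1 / 2 : ℚ) • F.toCompletion (-2) (F.br (by norm_num) g g)) :
    FreeGLA.complDer dGen h' (-(1 / 2 : ℚ) • F.toCompletion (-2) (F.br (by norm_num) g g)) = 0 := by
  have T := br_triple F.completion (F.toCompletion (-1) g)
  rw [map_smul, FreeGLA.toCompletion_br, FreeGLA.complDer_br dGen _ h h h' (by norm_num)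
    (by norm_num), hg, FreeGLA.toCompletion_br, map_smul, map_smul, LinearMap.smul_apply,
    F.completion.antisymm (by norm_num) (by norm_num) (F.completion.br _ _ _), T]
  simp

theorem d_dGen (g : LSGen) (q r : ℤ) (h : q + 1 = deg g) (h' : r + 1 = q) :
    FreeGLA.complDer dGen h' (dGen g q h) = 0 := by
  cases g with
  | a =>
    obtain rfl : q = -2 := by simp only [deg] at h; omega
    obtain rfl : r = -3 := by omega
    exact d_d_mc fa h h' rfl
  | b =>
    obtain rfl : q = -2 := by simp only [deg] at h; omega
    obtain rfl : r = -3 := by omega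
    exact d_d_mc fb h h' rfl
  | x =>
    obtain rfl : q = -1 := by simp only [deg] at h; omega
    obtain rfl : r = -2 := by omega
    refine Subtype.ext (funext fun n => ?_)
    have := LSAux.sq_zero ((F.quot n).ad (pr n 0 fx) (-1))
      ((F.quot n).ad (pr n 0 fx) (-2)) ((F.quot n).br (by norm_num))
      (FreeGLA.quotDer dGen n (by norm_num))
      (FreeGLA.quotDer dGen n (by norm_num) (pr n 0 fx)) n
      ((F.quot n).ad_br _ _) ?_ ?_ (quot_ad_pow_eq_zero n fx (-1)) (quot_ad_pow_eq_zero n fx (-2))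
      (pr n (-1) fa) (pr n (-1) fb) ?_ ?_ ?_
    · exact this
    · intro v w
      rw [(F.quot n).antisymm (by norm_num) (by norm_num) v w]
      norm_num
    · intro w
      refine (FreeGLA.quotDer_br dGen n (p' := -1) (q' := -2) (zero_add (-1)) (by norm_num) (by norm_num) (by norm_num)
        (by norm_num) (by norm_num) (pr n 0 fx) w).trans ?_
      rw [zpow_zero, one_smul]
      rfl
    · rfl
    · rfl
    · have hs : pr n (-1) (∑ i ∈ Finset.range n,
          (bernoulli i / (i.factorial : ℚ)) • (F.ad fx (-1) ^ i) (fb - fa)) =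
          ∑ i ∈ Finset.range n, (bernoulli i / (i.factorial : ℚ)) •
            ((F.quot n).ad (pr n 0 fx) (-1) ^ i) (pr n (-1) fb - pr n (-1) fa) := by
        rw [map_sum]
        refine Finset.sum_congr rfl fun i _ => ?_
        rw [map_smul, ← map_sub, quot_ad_pow]
      rw [← hs]
      rfl

end LSGen

/-- The Lawrence-Sullivan interval: the completion of the free graded Lie algebra on `a`, `b`, `x`
with the differential for which `a` and `b` are Maurer-Cartan elements and
`∂ x = [x, b] + ∑ (B_n / n!) ad_x ^ n (b - a)`. -/
noncomputable def LSInterval : DGL.{0} where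
  toGLA := LSGen.F.completion
  d := FreeGLA.complDer LSGen.dGen
  leibniz := FreeGLA.complDer_br LSGen.dGen
  d_d := FreeGLA.complDer_complDer LSGen.dGen LSGen.d_dGen

namespace LSInterval

/-- The generator `a` of the Lawrence-Sullivan interval. -/
noncomputable def a : LSInterval.X (-1) := LSGen.F.toCompletion (-1) LSGen.fa

/-- The generator `b` of the Lawrence-Sullivan interval. -/
noncomputable def b : LSInterval.X (-1) := LSGen.F.toCompletion (-1) LSGen.fb

/-- The generator `x` of the Lawrence-Sullivan interval. -/
noncomputable def x : LSInterval.X 0 := LSGen.F.toCompletion 0 LSGen.fx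


/-- The elements `a` and `b` are Maurer-Cartan elements. -/
theorem isMC_a : LSInterval.IsMC a :=
  (congrArg (· + _) (neg_smul (1 / 2 : ℚ) _)).trans (neg_add_cancel _)

theorem isMC_b : LSInterval.IsMC b :=
  (congrArg (· + _) (neg_smul (1 / 2 : ℚ) _)).trans (neg_add_cancel _)

/-- The formula for the differential of `x`. -/
theorem d_x : LSInterval.d (p := 0) (q := -1) (by norm_num) x =
    LSInterval.br (zero_add (-1)) x b + id (α := LSInterval.X (-1)) (LSGen.F.adSeries
      (fun n => bernoulli n / (n.factorial : ℚ)) LSGen.fx (LSGen.fb - LSGen.fa)) :=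
  rfl

end LSInterval

/-! Write D = ad_y, g(t) = (e^t - 1)/t and β(t) = ∑ B_n t^n / n!. Then gβ = 1 and e^t = 1 + t g(t),
so the gauge equation z' = e^D z - g(D)(∂y) says z' = z + g(D)(Dz - ∂y). Applying β(D) turns it into
∂y = [y, z] + β(D)(z - z'), which is the formula for ∂x with x, a, b replaced by y, z', z. This is
`DGL.gauge_eq_iff`. It is read modulo each L^(n+1), where D is nilpotent and every series is a
polynomial; completeness makes these congruences equivalent to the equation in L.

From 1 to 2, the completed free Lie algebra maps to the complete L with any prescribed values of the
generators (`FreeGLA.completeLift`). This map commutes with the differentials as soon as it does so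
on the generators (`FreeGLA.completeLift_complDer`). On a and b the condition is the Maurer-Cartan
equation of z' and z; on x it is the reformulated gauge equation.

From 2 to 1, φ is applied to the formula for ∂x. A DGL morphism is not assumed continuous, so its
value on an infinite series needs an argument. The tail of an ad-series lies in the algebraic lower
central series of the completion (`GLA.adSeries_sub_sum_mem_lcs`), and φ preserves lower central
series. Hence φ acts on the series term by term modulo each L^(n+1) (`LSInterval.mkQ_map_adSeries`).
-/

/-! ### Inverting the gauge formula for a nilpotent endomorphism. -/

/-- Since D ^ M = 0, truncation at order M loses nothing and `ev D M` is multiplicative. Thus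
`gSeries` and `bernoulliPowerSeries ℚ`, being inverse power series, act as inverse operators. -/
theorem LSAux.ev_exp_sub_ev_gSeries_eq_iff {V : Type*} [AddCommGroup V] [Module ℚ V]
    (D : Module.End ℚ V) (M : ℕ) (hD : D ^ M = 0) (u z z' : V) :
    ev D M (PowerSeries.exp ℚ) z - ev D M gSeries u = z' ↔
      u = D z + ev D M (bernoulliPowerSeries ℚ) (z - z') := by
  -- The identity e^t = t g(t) + 1, evaluated at D.
  have hexp : ev D M (PowerSeries.exp ℚ) z = ev D M gSeries (D z) + z := by
    have h1 : ev D M (PowerSeries.exp ℚ - 1) z = ev D M (PowerSeries.exp ℚ) z - ev D M 1 z := by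
      simp [ev]
    rw [← ev_X D M hD z, ← ev_mul D M hD, mul_comm, X_mul_gSeries, h1, ev_one D M hD,
      sub_add_cancel]
  have hgb (w : V) : ev D M gSeries (ev D M (bernoulliPowerSeries ℚ) w) = w := by
    rw [← ev_mul D M hD, bernoulli_mul_gSeries, ev_one D M hD]
  have hbg (w : V) : ev D M (bernoulliPowerSeries ℚ) (ev D M gSeries w) = w := by
    rw [← ev_mul D M hD, mul_comm, bernoulli_mul_gSeries, ev_one D M hD]
  rw [hexp]
  constructor
  · rintro rfl
    -- With z' eliminated, z - z' is g(D)(u - Dz), and the Bernoulli operator cancels g(D).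
    rw [show z - (ev D M gSeries (D z) + z - ev D M gSeries u) = ev D M gSeries (u - D z) by
      rw [map_sub]; abel, hbg]
    abel
  · rintro rfl
    rw [map_add, hgb]
    abel

/-! ### Ad-series in the nilpotent quotients and in the completion. -/

namespace GLA

/-- The injective half of completeness: it replaces limits by congruences modulo each L^(n+1). -/
theorem IsComplete.ext {L : GLA.{u}} (hL : L.IsComplete) {p : ℤ} {x y : L.X p}
    (h : ∀ n, (L.lcs n p).mkQ x = (L.lcs n p).mkQ y) : x = y :=
  (hL p).1 (Subtype.ext (funext h))

variable (L : GLA.{u})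

/-- The projection to the quotient `L / L ^ (n + 1)`. -/
def proj (n : ℕ) (p : ℤ) : L.X p →ₗ[ℚ] (L.quot n).X p := (L.lcs n p).mkQ

theorem quot_ad_proj_pow (n : ℕ) (y : L.X 0) {p : ℤ} (w : L.X p) (i : ℕ) :
    ((L.quot n).ad (L.proj n 0 y) p ^ i) (L.proj n p w) = L.proj n p ((L.ad y p ^ i) w) := by
  induction i with
  | zero => rfl
  | succ i ih =>
    rw [pow_succ', pow_succ', Module.End.mul_apply, Module.End.mul_apply, ih]
    rfl

/-- Each bracket with y descends one step in the lower central series, so n of them land in L^(n+1).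
This supplies the nilpotency needed by `LSAux.ev` with M = n. -/
theorem quot_ad_proj_pow_self (n : ℕ) (y : L.X 0) (p : ℤ) :
    (L.quot n).ad (L.proj n 0 y) p ^ n = 0 := by
  refine LinearMap.ext fun w => ?_
  obtain ⟨w, rfl⟩ := (L.lcs n p).mkQ_surjective w
  exact (L.quot_ad_proj_pow n y w n).trans
    ((Submodule.Quotient.mk_eq_zero _).2 (ad_pow_mem_lcs y w n))

/-- The right side is the n-th component of `adSeries`, so power series identities proved with
`LSAux.ev` transfer to the completion. -/
theorem ev_quot_ad_proj (n : ℕ) (y : L.X 0) {p : ℤ} (w : L.X p) (f : PowerSeries ℚ) :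
    LSAux.ev ((L.quot n).ad (L.proj n 0 y) p) n f (L.proj n p w) =
      L.proj n p (∑ i ∈ Finset.range n, PowerSeries.coeff i f • (L.ad y p ^ i) w) := by
  rw [LSAux.ev_apply, map_sum]
  refine Finset.sum_congr rfl fun i _ => ?_
  rw [map_smul, quot_ad_proj_pow]

/-- The recursion `∑ c_i ad_x ^ i (w) = c_0 w + [x, ∑ c_(i+1) ad_x ^ i (w)]`. -/
theorem adSeries_eq_add_br (c : ℕ → ℚ) (x : L.X 0) {p : ℤ} (w : L.X p) :
    L.adSeries c x w = c 0 • L.toCompletion p w +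
      L.completion.br (zero_add p) (L.toCompletion 0 x) (L.adSeries (fun i => c (i + 1)) x w) := by
  refine Subtype.ext (funext fun n => ?_)
  -- The n-th component is replaced by the image of the next one, which has n + 1 terms. Splitting
  -- off the term of index 0 then leaves the n terms of the shifted series at level n.
  rw [← (L.adSeries c x w).2 n]
  change (L.lcs n p).mkQ (∑ i ∈ Finset.range (n + 1), c i • (L.ad x p ^ i) w) =
    (L.lcs n p).mkQ (c 0 • w + L.ad x p (∑ i ∈ Finset.range n, c (i + 1) • (L.ad x p ^ i) w))
  rw [Finset.sum_range_succ', map_sum, add_comm]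
  simp only [map_smul, pow_succ', Module.End.mul_apply, pow_zero, Module.End.one_apply]

/-- The tail is an honest n-fold bracket: ad_x ^ n applied to the series with coefficients shifted
by n. It therefore lies in the lower central series of the completion itself, with no closure taken,
and a merely algebraic morphism can control it. The induction varies c because each step shifts the
coefficients. -/
theorem adSeries_sub_sum_mem_lcs (n : ℕ) (c : ℕ → ℚ) (x : L.X 0) {p : ℤ} (w : L.X p) :
    L.adSeries c x w - L.toCompletion p (∑ i ∈ Finset.range n, c i • (L.ad x p ^ i) w) ∈
      L.completion.lcs n p := by
  induction n generalizing c with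
  | zero => trivial
  | succ n ih =>
    have h := br_mem_lcs_succ (zero_add p) (L.toCompletion 0 x) (ih fun i => c (i + 1))
    have hs : ∑ i ∈ Finset.range (n + 1), c i • (L.ad x p ^ i) w = c 0 • w +
        L.br (zero_add p) x (∑ i ∈ Finset.range n, c (i + 1) • (L.ad x p ^ i) w) := by
      rw [Finset.sum_range_succ', map_sum, add_comm]
      simp only [map_smul, pow_succ', Module.End.mul_apply, pow_zero, Module.End.one_apply]
      rfl
    rwa [adSeries_eq_add_br, hs, map_add, map_smul, FreeGLA.toCompletion_br, add_sub_add_left_eq_sub,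
      ← map_sub]

end GLA

/-! ### The differential modulo the lower central series, and the gauge equation solved for ∂y. -/

namespace DGL

variable (L : DGL.{u})

/-- By Leibniz, ∂[x, y] is a combination of [∂x, y] and [x, ∂y], and the second entries stay at the
depth of y by induction. Hence ∂ descends to every quotient. -/
theorem d_mem_lcs (n : ℕ) {p q : ℤ} (h : q + 1 = p) {w : L.X p} (hw : w ∈ L.lcs n p) :
    L.d h w ∈ L.lcs n q := by
  induction n generalizing p q with
  | zero => trivial
  | succ n ih =>
    refine (Submodule.span_le (p := (L.lcs (n + 1) q).comap (L.d h))).2 ?_ hw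
    rintro _ ⟨i, j, hij, x, y, hy, rfl⟩
    rw [SetLike.mem_coe, Submodule.mem_comap,
      L.leibniz hij (sub_add_cancel i 1) (sub_add_cancel j 1) h (by omega) (by omega)]
    exact add_mem (GLA.br_mem_lcs_succ _ _ hy)
      (Submodule.smul_mem _ _ (GLA.br_mem_lcs_succ _ _ (ih _ hy)))

theorem mkQ_d_congr (n : ℕ) {p q : ℤ} (h : q + 1 = p) {x y : L.X p}
    (hxy : (L.lcs n p).mkQ x = (L.lcs n p).mkQ y) :
    (L.lcs n q).mkQ (L.d h x) = (L.lcs n q).mkQ (L.d h y) := by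
  rw [Submodule.mkQ_apply, Submodule.mkQ_apply, Submodule.Quotient.eq] at hxy ⊢
  rw [← map_sub]
  exact L.d_mem_lcs n h hxy

/-- `y 𝒢 z = z'` amounts to `∂ y = [y, z] + ∑ (B_n / n!) ad_y ^ n (z - z')`, read modulo every term
of the lower central series. -/
theorem gauge_eq_iff (hL : L.IsComplete) (y : L.X 0) (z z' : L.X (-1)) :
    L.gauge hL y z = z' ↔ ∀ n, (L.lcs n (-1)).mkQ (L.d (by norm_num) y) =
      (L.lcs n (-1)).mkQ (L.br (zero_add (-1)) y z + ∑ i ∈ Finset.range n,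
        (bernoulli i / (i.factorial : ℚ)) • (L.ad y (-1) ^ i) (z - z')) := by
  rw [gauge, LinearEquiv.symm_apply_eq]
  refine Subtype.ext_iff.trans (funext_iff.trans (forall_congr' fun n => ?_))
  -- The nilpotent inversion is applied in L / L^(n+1) to the class of ad_y, with the class of ∂y in
  -- the role of u.
  have key := LSAux.ev_exp_sub_ev_gSeries_eq_iff _ n (L.quot_ad_proj_pow_self n y (-1))
    (L.proj n (-1) (L.d (q := -1) (by norm_num) y)) (L.proj n (-1) z) (L.proj n (-1) z')
  rw [← map_sub (L.proj n (-1)) z, L.ev_quot_ad_proj, L.ev_quot_ad_proj, L.ev_quot_ad_proj] at key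
  simp only [PowerSeries.coeff_exp, LSAux.gSeries, bernoulliPowerSeries, PowerSeries.coeff_mk,
    Algebra.algebraMap_self, RingHom.id_apply] at key
  rw [map_add]
  exact key

end DGL

/-! ### Universal property of the completed free graded Lie algebra. -/

namespace FreeGLA

variable {G : Type} {deg : G → ℤ} {L : GLA.{u}} (f : ∀ g : G, L.X (deg g))

/-- The value in `L` of a formal Lie expression, for prescribed values `f` of the generators. -/
def termLift : ∀ {p : ℤ}, Term deg p → L.X p
  | _, .of g => f g
  | _, .zero _ => 0
  | _, .add s t => termLift s + termLift t
  | _, .smul c t => c • termLift t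
  | _, .br h s t => L.br h (termLift s) (termLift t)

/-- The generating relations are exactly axioms valid in every graded Lie algebra, in particular in
L. -/
theorem termLift_rel {p : ℤ} {s t : Term deg p} (h : Rel deg s t) :
    termLift f s = termLift f t := by
  induction h with
  | refl s => rfl
  | symm _ ih => exact ih.symm
  | trans _ _ ih ih' => exact ih.trans ih'
  | add_congr _ _ ih ih' => simp only [termLift, ih, ih']
  | smul_congr c _ ih => simp only [termLift, ih]
  | br_congr h _ _ ih ih' => simp only [termLift, ih, ih']
  | add_assoc s t u => exact add_assoc _ _ _
  | add_comm s t => exact add_comm _ _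
  | zero_add s => exact zero_add _
  | neg_add s => simp only [termLift, neg_one_smul, neg_add_cancel]
  | one_smul s => exact one_smul _ _
  | mul_smul c c' s => exact mul_smul _ _ _
  | smul_add c s t => exact smul_add _ _ _
  | add_smul c c' s => exact add_smul _ _ _
  | add_br h s s' t => simp only [termLift, map_add, LinearMap.add_apply]
  | smul_br h c s t => simp only [termLift, map_smul, LinearMap.smul_apply]
  | br_add h s t t' => simp only [termLift, map_add]
  | br_smul h c s t => simp only [termLift, map_smul]
  | antisymm h h' s t => simpa only [termLift, neg_one_smul] using L.antisymm h h' _ _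
  | jacobi hpq hqr hrp h₁ h₂ h₃ s t u => exact L.jacobi hpq hqr hrp h₁ h₂ h₃ _ _ _

/-- The morphism from the free graded Lie algebra with prescribed values `f` on the generators. -/
def lift (p : ℤ) : (FreeGLA deg).X p →ₗ[ℚ] L.X p where
  toFun := Quotient.lift (fun t => termLift f t) fun _ _ hst => termLift_rel f hst
  map_add' x y := by
    obtain ⟨s, rfl⟩ := cls_surjective x
    obtain ⟨t, rfl⟩ := cls_surjective y
    rfl
  map_smul' c x := by
    obtain ⟨s, rfl⟩ := cls_surjective x
    rfl

theorem lift_br {p q r : ℤ} (h : p + q = r) (x : (FreeGLA deg).X p) (y : (FreeGLA deg).X q) :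
    lift f r ((FreeGLA deg).br h x y) = L.br h (lift f p x) (lift f q y) := by
  obtain ⟨s, rfl⟩ := cls_surjective x
  obtain ⟨t, rfl⟩ := cls_surjective y
  rfl

theorem lift_ad_pow (x : (FreeGLA deg).X 0) {p : ℤ} (w : (FreeGLA deg).X p) (i : ℕ) :
    lift f p (((FreeGLA deg).ad x p ^ i) w) = (L.ad (lift f 0 x) p ^ i) (lift f p w) := by
  induction i with
  | zero => rfl
  | succ i ih =>
    rw [pow_succ', pow_succ', Module.End.mul_apply, Module.End.mul_apply, ← ih]
    exact lift_br f _ _ _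

theorem lift_mem_lcs (n : ℕ) {p : ℤ} {w : (FreeGLA deg).X p} (hw : w ∈ (FreeGLA deg).lcs n p) :
    lift f p w ∈ L.lcs n p := by
  induction n generalizing p with
  | zero => trivial
  | succ n ih =>
    refine (Submodule.span_le (p := (L.lcs (n + 1) p).comap (lift f p))).2 ?_ hw
    rintro _ ⟨i, j, hij, x, y, hy, rfl⟩
    rw [SetLike.mem_coe, Submodule.mem_comap, lift_br]
    exact GLA.br_mem_lcs_succ _ _ (ih hy)

/-- The map induced by `lift` on the quotients by the lower central series. -/
def quotLift (n : ℕ) (p : ℤ) : ((FreeGLA deg).quot n).X p →ₗ[ℚ] (L.quot n).X p :=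
  ((FreeGLA deg).lcs n p).mapQ (L.lcs n p) (lift f p) fun _ hw => lift_mem_lcs f n hw

theorem quotLift_mk (n : ℕ) {p : ℤ} (x : (FreeGLA deg).X p) :
    quotLift f n p (((FreeGLA deg).lcs n p).mkQ x) = (L.lcs n p).mkQ (lift f p x) := rfl

theorem quotLift_br (n : ℕ) {p q r : ℤ} (h : p + q = r) (x : ((FreeGLA deg).quot n).X p)
    (y : ((FreeGLA deg).quot n).X q) :
    quotLift f n r (((FreeGLA deg).quot n).br h x y) =
      (L.quot n).br h (quotLift f n p x) (quotLift f n q y) := by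
  obtain ⟨x, rfl⟩ := ((FreeGLA deg).lcs n p).mkQ_surjective x
  obtain ⟨y, rfl⟩ := ((FreeGLA deg).lcs n q).mkQ_surjective y
  exact congrArg (L.lcs n r).mkQ (lift_br f h x y)

/-- The continuous extension of `lift` to the completions. -/
def complLift (p : ℤ) : (FreeGLA deg).completion.X p →ₗ[ℚ] L.completion.X p where
  toFun w := ⟨fun n => quotLift f n p (w.1 n), fun n => by
    -- One element of the free algebra represents both the component n + 1 and the component n.
    obtain ⟨x, hx⟩ := ((FreeGLA deg).lcs (n + 1) p).mkQ_surjective (w.1 (n + 1))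
    have hx' : ((FreeGLA deg).lcs n p).mkQ x = w.1 n := by
      rw [← w.2 n, ← hx, GLA.trans_mk]
    change L.trans n p (quotLift f (n + 1) p (w.1 (n + 1))) = quotLift f n p (w.1 n)
    rw [← hx, ← hx']
    rfl⟩
  map_add' x y := Subtype.ext (funext fun n => map_add (quotLift f n p) (x.1 n) (y.1 n))
  map_smul' c x := Subtype.ext (funext fun n => map_smul (quotLift f n p) c (x.1 n))

theorem complLift_br {p q r : ℤ} (h : p + q = r) (x : (FreeGLA deg).completion.X p)
    (y : (FreeGLA deg).completion.X q) :
    complLift f r ((FreeGLA deg).completion.br h x y) =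
      L.completion.br h (complLift f p x) (complLift f q y) :=
  Subtype.ext (funext fun n => quotLift_br f n h (x.1 n) (y.1 n))

section Differential

variable {L : DGL.{u}} (f : ∀ g : G, L.X (deg g))
  (v : ∀ (g : G) (q : ℤ), q + 1 = deg g → (FreeGLA deg).completion.X q)

/-- `lift` commutes with the derivations as soon as it does so on the generators. -/
theorem complLift_freeDer
    (hv : ∀ (g : G) (q : ℤ) (h : q + 1 = deg g),
      complLift (L := L.toGLA) f q (v g q h) = L.toCompletion q (L.d h (f g)))
    {p q : ℤ} (h : q + 1 = p) (x : (FreeGLA deg).X p) :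
    complLift (L := L.toGLA) f q (freeDer v h x) =
      L.toCompletion q (L.d h (lift (L := L.toGLA) f p x)) := by
  obtain ⟨t, rfl⟩ := cls_surjective x
  induction t generalizing q with
  | of g => exact hv g q h
  | zero p => simp only [cls_zero, map_zero]
  | add s t ih ih' => simp only [cls_add, map_add, ih, ih']
  | smul c t ih => simp only [cls_smul, map_smul, ih]
  | @br i j k hij s t ih ih' =>
    rw [cls_br, freeDer_br v hij (sub_add_cancel i 1) (sub_add_cancel j 1) h (by omega) (by omega),
      map_add, map_smul, complLift_br, complLift_br, ih, ih', lift_br,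
      L.leibniz hij (sub_add_cancel i 1) (sub_add_cancel j 1) h (by omega) (by omega),
      map_add, map_smul]
    -- What remains is that `complLift` of the image of a free element is the image of its `lift`.
    rfl

/-- The DGL morphism from the completed free graded Lie algebra to a complete DGL with prescribed
values on the generators, on underlying graded vector spaces. -/
noncomputable def completeLift (hL : L.IsComplete) (p : ℤ) :
    (FreeGLA deg).completion.X p →ₗ[ℚ] L.X p :=
  (LinearEquiv.ofBijective (L.toCompletion p) (hL p)).symm.toLinearMap ∘ₗ
    complLift (L := L.toGLA) f p

/-- As the canonical map is injective, this determines `completeLift`; its properties are checked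
after passing to the completion. -/
theorem toCompletion_completeLift (hL : L.IsComplete) {p : ℤ}
    (w : (FreeGLA deg).completion.X p) :
    L.toCompletion p (completeLift f hL p w) = complLift (L := L.toGLA) f p w :=
  (LinearEquiv.ofBijective (L.toCompletion p) (hL p)).apply_symm_apply _

theorem completeLift_of (hL : L.IsComplete) (g : G) :
    completeLift f hL (deg g) ((FreeGLA deg).toCompletion _ (of g)) = f g :=
  (hL _).1 (toCompletion_completeLift f hL _)

theorem completeLift_br (hL : L.IsComplete) {p q r : ℤ} (h : p + q = r)
    (x : (FreeGLA deg).completion.X p) (y : (FreeGLA deg).completion.X q) :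
    completeLift f hL r ((FreeGLA deg).completion.br h x y) =
      L.br h (completeLift f hL p x) (completeLift f hL q y) := by
  apply (hL r).1
  rw [toCompletion_completeLift, complLift_br, toCompletion_br, toCompletion_completeLift,
    toCompletion_completeLift]

/-- Modulo L^(n+1), w may be replaced by an element of the free algebra, because the lift and both
differentials respect the filtrations. There the claim is `complLift_freeDer`. -/
theorem completeLift_complDer (hL : L.IsComplete)
    (hv : ∀ (g : G) (q : ℤ) (h : q + 1 = deg g),
      complLift (L := L.toGLA) f q (v g q h) = L.toCompletion q (L.d h (f g)))
    {p q : ℤ} (h : q + 1 = p) (w : (FreeGLA deg).completion.X p) :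
    completeLift f hL q (complDer v h w) = L.d h (completeLift f hL p w) := by
  refine hL.ext fun n => ?_
  obtain ⟨x, hx⟩ := ((FreeGLA deg).lcs n p).mkQ_surjective (w.1 n)
  have h₁ : (L.lcs n q).mkQ (completeLift f hL q (complDer v h w)) =
      quotLift (L := L.toGLA) f n q (quotDer v n h (w.1 n)) :=
    congrArg (fun w => w.1 n) (toCompletion_completeLift f hL (complDer v h w))
  have h₂ : (L.lcs n p).mkQ (completeLift f hL p w) =
      (L.lcs n p).mkQ (lift (L := L.toGLA) f p x) := by
    rw [← quotLift_mk, hx]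
    exact congrArg (fun w => w.1 n) (toCompletion_completeLift f hL w)
  rw [h₁, L.mkQ_d_congr n h h₂, ← hx, quotDer_mk]
  exact congrArg (fun w => w.1 n) (complLift_freeDer f v hv h x)

end Differential

end FreeGLA

/-! ### Automatic continuity of DGL morphisms. -/

namespace DGLHom

variable {L : DGL.{u}} {M : DGL.{v}} (φ : DGLHom L M)

/-- Preserving brackets is enough to preserve iterated brackets; this serves as continuity for
morphisms out of the Lawrence-Sullivan interval. -/
theorem map_mem_lcs (n : ℕ) {p : ℤ} {w : L.X p} (hw : w ∈ L.lcs n p) :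
    φ.toFun p w ∈ M.lcs n p := by
  induction n generalizing p with
  | zero => trivial
  | succ n ih =>
    refine (Submodule.span_le (p := (M.lcs (n + 1) p).comap (φ.toFun p))).2 ?_ hw
    rintro _ ⟨i, j, hij, x, y, hy, rfl⟩
    rw [SetLike.mem_coe, Submodule.mem_comap, φ.map_br]
    exact GLA.br_mem_lcs_succ _ _ (ih hy)

theorem map_ad_pow (x : L.X 0) {p : ℤ} (w : L.X p) (i : ℕ) :
    φ.toFun p ((L.ad x p ^ i) w) = (M.ad (φ.toFun 0 x) p ^ i) (φ.toFun p w) := by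
  induction i with
  | zero => rfl
  | succ i ih =>
    rw [pow_succ', pow_succ', Module.End.mul_apply, Module.End.mul_apply, ← ih]
    exact φ.map_br _ _ _

end DGLHom

namespace GLA

theorem toCompletion_ad_pow (L : GLA.{u}) (x : L.X 0) {p : ℤ} (w : L.X p) (i : ℕ) :
    L.toCompletion p ((L.ad x p ^ i) w) =
      (L.completion.ad (L.toCompletion 0 x) p ^ i) (L.toCompletion p w) := by
  induction i with
  | zero => rfl
  | succ i ih =>
    rw [pow_succ', pow_succ', Module.End.mul_apply, Module.End.mul_apply, ← ih]
    rfl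

end GLA

/-! ### Morphisms out of the Lawrence-Sullivan interval. -/

namespace LSInterval

variable {L : DGL.{u}}

/-- On the finite partial sum φ acts term by term, and it sends the tail into L^(n+1). -/
theorem mkQ_map_adSeries (φ : DGLHom LSInterval L) (c : ℕ → ℚ) (w : LSGen.F.X (-1)) (n : ℕ) :
    (L.lcs n (-1)).mkQ (φ.toFun (-1) (LSGen.F.adSeries c LSGen.fx w)) =
      (L.lcs n (-1)).mkQ (∑ i ∈ Finset.range n, c i • (L.ad (φ.toFun 0 x) (-1) ^ i)
        (φ.toFun (-1) (LSGen.F.toCompletion (-1) w))) := by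
  have hs : φ.toFun (-1) (LSGen.F.toCompletion (-1)
      (∑ i ∈ Finset.range n, c i • (LSGen.F.ad LSGen.fx (-1) ^ i) w)) =
      ∑ i ∈ Finset.range n, c i • (L.ad (φ.toFun 0 x) (-1) ^ i)
        (φ.toFun (-1) (LSGen.F.toCompletion (-1) w)) := by
    rw [map_sum]
    refine (map_sum (φ.toFun (-1)) _ _).trans (Finset.sum_congr rfl fun i _ => ?_)
    rw [map_smul, GLA.toCompletion_ad_pow]
    exact (map_smul (φ.toFun (-1)) _ _).trans
      (congrArg (c i • ·) (φ.map_ad_pow x (LSGen.F.toCompletion (-1) w) i))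
  rw [← hs, Submodule.mkQ_apply, Submodule.mkQ_apply, Submodule.Quotient.eq]
  have hm := φ.map_mem_lcs n (LSGen.F.adSeries_sub_sum_mem_lcs n c LSGen.fx w)
  exact (map_sub (φ.toFun (-1)) (_ : LSInterval.X (-1)) _) ▸ hm

/-- The values of the generators under a morphism sending `a`, `b`, `x` to `z'`, `z`, `y`. -/
def genValue (z z' : L.X (-1)) (y : L.X 0) : ∀ g : LSGen, L.X (LSGen.deg g)
  | .a => z'
  | .b => z
  | .x => y

theorem d_eq_of_isMC {z : L.X (-1)} (hz : L.IsMC z) (h : (-2 : ℤ) + 1 = -1) :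
    L.d h z = -(1 / 2 : ℚ) • L.br (r := -2) (by norm_num) z z := by
  rw [neg_smul]
  exact eq_neg_of_add_eq_zero_left hz

/-- The compatibility on generators required by `FreeGLA.completeLift_complDer`: the Maurer-Cartan
equations settle a and b, the gauge equation settles x. -/
theorem complLift_dGen (hL : L.IsComplete) {z z' : L.X (-1)} (hz : L.IsMC z) (hz' : L.IsMC z')
    {y : L.X 0} (hy : L.gauge hL y z = z') (g : LSGen) (q : ℤ) (h : q + 1 = LSGen.deg g) :
    FreeGLA.complLift (L := L.toGLA) (genValue z z' y) q (LSGen.dGen g q h) =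
      L.toCompletion q (L.d h (genValue z z' y g)) := by
  cases g with
  | a =>
    obtain rfl : q = -2 := by simp only [LSGen.deg] at h; omega
    exact (congrArg (L.toCompletion (-2)) (d_eq_of_isMC hz' h)).symm
  | b =>
    obtain rfl : q = -2 := by simp only [LSGen.deg] at h; omega
    exact (congrArg (L.toCompletion (-2)) (d_eq_of_isMC hz h)).symm
  | x =>
    obtain rfl : q = -1 := by simp only [LSGen.deg] at h; omega
    -- By `gauge_eq_iff` the class of ∂y is the Bernoulli expression in y, z, z'; it remains to
    -- recognise the n-th component of the image of ∂x in it.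
    refine Subtype.ext (funext fun n => Eq.trans ?_ ((L.gauge_eq_iff hL y z z').1 hy n).symm)
    have hs : FreeGLA.lift (L := L.toGLA) (genValue z z' y) (-1)
        (∑ i ∈ Finset.range n, (bernoulli i / (i.factorial : ℚ)) •
          (LSGen.F.ad LSGen.fx (-1) ^ i) (LSGen.fb - LSGen.fa)) =
        ∑ i ∈ Finset.range n, (bernoulli i / (i.factorial : ℚ)) • (L.ad y (-1) ^ i) (z - z') := by
      rw [map_sum]
      refine Finset.sum_congr rfl fun i _ => ?_
      rw [map_smul, FreeGLA.lift_ad_pow, map_sub]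
      rfl
    have hyz : FreeGLA.lift (L := L.toGLA) (genValue z z' y) (-1)
        (LSGen.F.br (zero_add (-1)) LSGen.fx LSGen.fb) = L.br (zero_add (-1)) y z := rfl
    rw [← hs, ← hyz, ← map_add (FreeGLA.lift (L := L.toGLA) (genValue z z' y) (-1))]
    rfl

/-- The DGL morphism sending `a`, `b`, `x` to `z'`, `z`, `y`. -/
noncomputable def homOfGauge (hL : L.IsComplete) {z z' : L.X (-1)} (hz : L.IsMC z)
    (hz' : L.IsMC z') {y : L.X 0} (hy : L.gauge hL y z = z') : DGLHom LSInterval L where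
  toFun := FreeGLA.completeLift (genValue z z' y) hL
  map_br := FreeGLA.completeLift_br (genValue z z' y) hL
  map_d := FreeGLA.completeLift_complDer (genValue z z' y) LSGen.dGen hL
    (complLift_dGen hL hz hz' hy)

end LSInterval

/-! ### The equivalence. -/

/-- For a complete DGL `L`, Maurer-Cartan elements `z`, `z'` of `L` and `y` of degree `0`, one has
`y 𝒢 z = z'` if and only if there is a DGL morphism from the Lawrence-Sullivan interval to `L`
sending `a` to `z'`, `b` to `z` and `x` to `y`. -/
theorem mainTheorem5 (L : DGL.{u}) (hL : L.IsComplete) (z z' : L.X (-1)) (hz : L.IsMC z)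
    (hz' : L.IsMC z') (y : L.X 0) :
    L.gauge hL y z = z' ↔
      ∃ φ : DGLHom LSInterval L, φ.toFun (-1) LSInterval.a = z' ∧
        φ.toFun (-1) LSInterval.b = z ∧ φ.toFun 0 LSInterval.x = y := by
  constructor
  · intro hy
    exact ⟨LSInterval.homOfGauge hL hz hz' hy,
      FreeGLA.completeLift_of (LSInterval.genValue z z' y) hL .a,
      FreeGLA.completeLift_of (LSInterval.genValue z z' y) hL .b,
      FreeGLA.completeLift_of (LSInterval.genValue z z' y) hL .x⟩
  · rintro ⟨φ, rfl, rfl, rfl⟩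
    refine (L.gauge_eq_iff hL _ _ _).2 fun n => ?_
    have hba : φ.toFun (-1) (LSGen.F.toCompletion (-1) (LSGen.fb - LSGen.fa)) =
        φ.toFun (-1) LSInterval.b - φ.toFun (-1) LSInterval.a :=
      (congrArg (φ.toFun (-1)) (map_sub (LSGen.F.toCompletion (-1)) _ _)).trans
        (map_sub (φ.toFun (-1)) LSInterval.b LSInterval.a)
    -- Since φ commutes with ∂, the class of ∂y is the class of φ(∂x). The bracket terms agree at
    -- once, leaving the Bernoulli series in b - a.
    rw [← φ.map_d, LSInterval.d_x, map_add, map_add, map_add, φ.map_br, ← hba]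
    exact congrArg (_ + ·) (LSInterval.mkQ_map_adSeries φ _ _ n)
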